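/- **Equidistribution of unitaries and states from spectral gap.** Let $d\ge 1$. Let $\mathbf U(d)$ be the compact group of unitary channels $\mathcal U(\rho)=U\rho U^\dagger$ on $d\times d$ complex matrices, with Haar probability measure $\mu$ and distance $\mathrm d(\mathcal U,\mathcal V)=\min_{\varphi}\|U-e^{i\varphi}V\|_\infty$ (operator norm). Let $\mathcal S(d)$ be the set of pure states (rank-one projectors) with distance $\mathrm d(\rho,\sigma)=\tfrac12\|\rho-\sigma\|_1$. For a probability measure $\nu$ on $\mathbf U(d)$ and a reference state $\phi_0\in\mathcal S(d)$ let $\nu_{\mathcal S}$ be the law of $\mathcal U(\phi_0)$ for $\mathcal U\sim\nu$; in particular $\mu_{\mathcal S}$ is the uniform measure on $\mathcal S(d)$, which does not depend on $\phi_0$. Balls $B(\cdot,R)$ are closed, and $\mathrm{Vol}(R)$, $\mathrm{Vol}_{\mathcal S}(R)$ denote the $\mu$-, respectively $\mu_{\mathcal S}$-measure of a ball of radius $R$. A probability measure $\nu$ on $\mathbf U(d)$ is $(\alpha,\beta)$-equidistributed at scale $\varepsilon$ if $\mathrm{Vol}(\alpha R)\le\nu(B(\mathcal V,R))\le\mathrm{Vol}(\beta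 R)$ for all $\mathcal V\in\mathbf U(d)$ and $R\ge\varepsilon$; for probability measures on $\mathcal S(d)$ the definition is the same with $\mathrm{Vol}_{\mathcal S}$. The averaging operator $M_\nu$ on $L^2(\mathbf U(d),\mu)$ is $(M_\nu f)(\mathcal U)=\int f(\mathcal V^{-1}\mathcal U)\,d\nu(\mathcal V)$, and $\|\cdot\|_\infty$ also denotes the operator norm on $L^2$. Call $c_o,c^o>0$ *volume constants* if $(c_o r)^{d^2-1}\le\mathrm{Vol}(r)\le(c^o r)^{d^2-1}$ for all $d\ge1$ and all $0<r\le 2$ (no distance in $\mathbf U(d)$ exceeds $2$), and put $$C_1(c_o,c^o)=\frac{c_o^{3/2}}{4(c^o)^{1/2}}\sqrt{\tfrac23},\qquad C_2=\tfrac14\sqrt{\tfrac23}.$$ (0) $c_o=\frac1{9\pi}$, $c^o=87$ are volume constants. Now let $d\ge1$, $\varepsilon>0$, and let $\nu$ be a Borel probability measure on $\mathbf U(d)$. (1) Let $0<\alpha\le1\le\beta$ and $m=\min\Big\{\big(\tfrac{(\beta-1)^3}{\beta+1}\big)^{1/2},\big(\tfrac{(1-\alpha)^3}{1+\alpha}\big)^{1/2}\Big\}$.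 If $c_o,c^o$ are volume constants and $$\|M_\nu-M_\mu\|_\infty\le\Big(\sqrt{\tfrac32}\,C_1(c_o,c^o)\,\varepsilon\,m\Big)^{d^2-1},$$ then $\nu$ is $(\alpha,\beta)$-equidistributed at scale $\varepsilon$. If $$\|M_\nu-M_\mu\|_\infty\le\Big(\sqrt{\tfrac32}\,C_2\,\varepsilon\,m\Big)^{2(d-1)},$$ then, for every reference state, $\nu_{\mathcal S}$ is $(\alpha,\beta)$-equidistributed at scale $\varepsilon$. (2) Let $\Gamma\in(0,1)$. If $\|M_\nu-M_\mu\|_\infty\le(C_1\varepsilon\Gamma^{3/2})^{d^2-1}$ with $C_1=C_1(\tfrac1{9\pi},87)$, then $\nu$ is $(1-\Gamma,1+\Gamma)$-equidistributed at scale $\varepsilon$. If $\|M_\nu-M_\mu\|_\infty\le(C_2\varepsilon\Gamma^{3/2})^{2(d-1)}$, then, for every reference state, $\nu_{\mathcal S}$ is $(1-\Gamma,1+\Gamma)$-equidistributed at scale $\varepsilon$. -/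

import Mathlib

open MeasureTheory
open scoped Matrix

noncomputable section

/-- The kernel of `U ↦ (ρ ↦ U ρ U†)`: the unitary matrices that define the identity channel. -/
abbrev phaseSubgroup (d : ℕ) : Subgroup (Matrix.unitaryGroup (Fin d) ℂ) :=
  (Unitary.conjStarAlgAut ℂ (Matrix (Fin d) (Fin d) ℂ)).ker

/-- The group of unitary channels `ρ ↦ U ρ U†` on `d × d` matrices, as the group of unitary
matrices modulo equality of the associated channels, with the quotient topology. -/
abbrev UnitaryChannel (d : ℕ) : Type :=
  Matrix.unitaryGroup (Fin d) ℂ ⧸ phaseSubgroup d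

/-- The channel `ρ ↦ U ρ U†` itself, as an automorphism of the matrix algebra. -/
def UnitaryChannel.toAut {d : ℕ} :
    UnitaryChannel d →* (Matrix (Fin d) (Fin d) ℂ ≃⋆ₐ[ℂ] Matrix (Fin d) (Fin d) ℂ) :=
  QuotientGroup.kerLift _

/-- Operator norm of a matrix with respect to the Euclidean norm. -/
def matrixOpNorm {d : ℕ} (A : Matrix (Fin d) (Fin d) ℂ) : ℝ :=
  ‖Matrix.toEuclideanCLM (n := Fin d) (𝕜 := ℂ) A‖

/-- `min_φ ‖U - exp(i φ) V‖` for unitary matrices. -/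
def phaseDist {d : ℕ} (U V : Matrix.unitaryGroup (Fin d) ℂ) : ℝ :=
  ⨅ φ : ℝ, matrixOpNorm
    ((U : Matrix (Fin d) (Fin d) ℂ) - Complex.exp (φ * Complex.I) • (V : Matrix (Fin d) (Fin d) ℂ))

theorem exists_phase_of_mk_eq {d : ℕ} {U V : Matrix.unitaryGroup (Fin d) ℂ}
    (h : (QuotientGroup.mk U : UnitaryChannel d) = QuotientGroup.mk V) :
    ∃ θ : ℝ, (V : Matrix (Fin d) (Fin d) ℂ) =
      Complex.exp (θ * Complex.I) • (U : Matrix (Fin d) (Fin d) ℂ) := by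
  have h1 : Unitary.conjStarAlgAut ℂ (Matrix (Fin d) (Fin d) ℂ) V
      = Unitary.conjStarAlgAut ℂ (Matrix (Fin d) (Fin d) ℂ) U :=
    (congrArg UnitaryChannel.toAut h).symm
  rcases isEmpty_or_nonempty (Fin d) with hd | hd
  · exact ⟨0, Subsingleton.elim _ _⟩
  obtain ⟨c, hc⟩ := (Unitary.conjStarAlgAut_ext_iff V U).1 h1
  have hn : ‖c‖ = 1 := by
    have hV : (V : Matrix (Fin d) (Fin d) ℂ) * star (V : Matrix (Fin d) (Fin d) ℂ) = 1 :=
      Unitary.mul_star_self_of_mem V.2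
    have hU : (U : Matrix (Fin d) (Fin d) ℂ) * star (U : Matrix (Fin d) (Fin d) ℂ) = 1 :=
      Unitary.mul_star_self_of_mem U.2
    rw [hc, star_smul, smul_mul_assoc, mul_smul_comm, hU, smul_smul] at hV
    have i : Fin d := Classical.arbitrary _
    have h2 := congrFun (congrFun hV i) i
    simp only [Matrix.smul_apply, Matrix.one_apply_eq, smul_eq_mul, mul_one] at h2
    have h3 : ‖c‖ * ‖c‖ = 1 := by
      simpa [norm_mul] using congrArg norm h2
    nlinarith [norm_nonneg c]
  refine ⟨c.arg, ?_⟩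
  rw [hc]
  congr 1
  have := Complex.norm_mul_exp_arg_mul_I c
  rw [hn] at this
  simpa using this.symm

theorem matrixOpNorm_phase_smul {d : ℕ} (θ : ℝ) (A : Matrix (Fin d) (Fin d) ℂ) :
    matrixOpNorm (Complex.exp (θ * Complex.I) • A) = matrixOpNorm A := by
  simp [matrixOpNorm, norm_smul, Complex.norm_exp_ofReal_mul_I]

theorem phaseDist_congr {d : ℕ} (U₁ V₁ U₂ V₂ : Matrix.unitaryGroup (Fin d) ℂ)
    (hU : (QuotientGroup.mk U₁ : UnitaryChannel d) = QuotientGroup.mk U₂)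
    (hV : (QuotientGroup.mk V₁ : UnitaryChannel d) = QuotientGroup.mk V₂) :
    phaseDist U₁ V₁ = phaseDist U₂ V₂ := by
  obtain ⟨a, ha⟩ := exists_phase_of_mk_eq hU
  obtain ⟨b, hb⟩ := exists_phase_of_mk_eq hV
  unfold phaseDist
  refine (Equiv.iInf_congr (Equiv.addRight (b - a)) fun φ => ?_).symm
  rw [ha, hb, ← matrixOpNorm_phase_smul a]
  congr 1
  rw [smul_sub, smul_smul, smul_smul, ← Complex.exp_add, ← Complex.exp_add]
  congr 3
  simp only [Equiv.coe_addRight]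
  push_cast
  ring

/-- The distance `d(𝒰, 𝒱) = min_φ ‖U - exp(i φ) V‖` between unitary channels. -/
def channelDist {d : ℕ} (x y : UnitaryChannel d) : ℝ :=
  Quotient.liftOn₂ x y phaseDist fun U₁ V₁ U₂ V₂ hU hV =>
    phaseDist_congr U₁ V₁ U₂ V₂ (Quotient.sound hU) (Quotient.sound hV)

/-- The closed ball of radius `r` around a unitary channel. -/
def channelBall {d : ℕ} (x : UnitaryChannel d) (r : ℝ) : Set (UnitaryChannel d) :=
  {y | channelDist y x ≤ r}

instance UnitaryChannel.instMeasurableSpace (d : ℕ) : MeasurableSpace (UnitaryChannel d) :=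
  borel _

instance UnitaryChannel.instBorelSpace (d : ℕ) : BorelSpace (UnitaryChannel d) := ⟨rfl⟩

instance Matrix.unitaryGroup.instCompactSpace (d : ℕ) :
    CompactSpace (Matrix.unitaryGroup (Fin d) ℂ) := by
  change CompactSpace ((Matrix.unitaryGroup (Fin d) ℂ : Set (Matrix (Fin d) (Fin d) ℂ)))
  refine isCompact_iff_compactSpace.1 ?_
  have hK : IsCompact (Set.pi Set.univ fun _ : Fin d => Set.pi Set.univ fun _ : Fin d =>
      Metric.closedBall (0 : ℂ) 1) :=
    isCompact_univ_pi fun _ => isCompact_univ_pi fun _ => isCompact_closedBall _ _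
  refine IsCompact.of_isClosed_subset (X := Matrix (Fin d) (Fin d) ℂ) hK ?_ ?_
  · have : (Matrix.unitaryGroup (Fin d) ℂ : Set (Matrix (Fin d) (Fin d) ℂ))
        = {A | A * star A = 1} := by
      ext A
      exact Matrix.mem_unitaryGroup_iff
    rw [this]
    exact isClosed_eq (by fun_prop) continuous_const
  · intro U hU i _ j _
    simpa using entry_norm_bound_of_unitary hU i j

instance Matrix.unitaryGroup.instSecondCountableTopology (d : ℕ) :
    SecondCountableTopology (Matrix.unitaryGroup (Fin d) ℂ) := by
  have : SecondCountableTopology (Matrix (Fin d) (Fin d) ℂ) :=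
    inferInstanceAs (SecondCountableTopology (Fin d → Fin d → ℂ))
  exact TopologicalSpace.Subtype.secondCountableTopology
    (Matrix.unitaryGroup (Fin d) ℂ : Set (Matrix (Fin d) (Fin d) ℂ))

/-- The Haar probability measure on the compact group of unitary channels. -/
def haarChannel (d : ℕ) : Measure (UnitaryChannel d) :=
  Measure.haarMeasure ⊤

instance haarChannel.instIsHaarMeasure (d : ℕ) : (haarChannel d).IsHaarMeasure := by
  unfold haarChannel
  infer_instance

instance haarChannel.instIsProbabilityMeasure (d : ℕ) : IsProbabilityMeasure (haarChannel d) :=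
  ⟨Measure.haarMeasure_self⟩

/-- The Haar volume of a ball of radius `r` in the group of unitary channels. -/
def channelVol (d : ℕ) (r : ℝ) : ℝ :=
  (haarChannel d).real (channelBall 1 r)

/-- A probability measure `ν` on unitary channels is `(α, β)`-equidistributed at scale `ε`. -/
def IsChannelEquidistributed {d : ℕ} (ν : Measure (UnitaryChannel d)) (α β ε : ℝ) : Prop :=
  ∀ (x : UnitaryChannel d) (R : ℝ), ε ≤ R →
    channelVol d (α * R) ≤ ν.real (channelBall x R) ∧
      ν.real (channelBall x R) ≤ channelVol d (β * R)

/-- `c` and `C` are admissible absolute constants in the two-sided estimate of the volumes of balls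
of unitary channels. The distance of two channels is at most `2`, so only radii up to `2` occur. -/
def IsVolumeConstants (c C : ℝ) : Prop :=
  0 < c ∧ 0 < C ∧ ∀ (d : ℕ) [NeZero d] (r : ℝ), 0 < r → r ≤ 2 →
    (c * r) ^ (d ^ 2 - 1) ≤ channelVol d r ∧ channelVol d r ≤ (C * r) ^ (d ^ 2 - 1)

/-! The averaging operator on `L²` of the Haar measure. -/

section Averaging

variable {d : ℕ} (ν : Measure (UnitaryChannel d)) [IsProbabilityMeasure ν]

theorem measurePreserving_inv_mul_prod :
    MeasurePreserving (fun p : UnitaryChannel d × UnitaryChannel d => p.2⁻¹ * p.1)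
      ((haarChannel d).prod ν) (haarChannel d) := by
  have hm : Measurable (fun p : UnitaryChannel d × UnitaryChannel d => p.2⁻¹ * p.1) := by
    fun_prop
  refine ⟨hm, Measure.ext fun s hs => ?_⟩
  rw [Measure.map_apply hm hs, Measure.prod_apply_symm (hm hs)]
  have : ∀ V : UnitaryChannel d, haarChannel d ((fun x => (x, V)) ⁻¹'
      ((fun p : UnitaryChannel d × UnitaryChannel d => p.2⁻¹ * p.1) ⁻¹' s)) = haarChannel d s :=
    fun V => measure_preimage_mul (haarChannel d) V⁻¹ s
  simp [this]

/-- `x ↦ ∫ f(V⁻¹ x) dν(V)`. -/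
def averagingFun (f : UnitaryChannel d → ℂ) (x : UnitaryChannel d) : ℂ :=
  ∫ V, f (V⁻¹ * x) ∂ν

theorem lintegral_sq_translate {f : UnitaryChannel d → ℂ} (hf : StronglyMeasurable f) :
    ∫⁻ x, ∫⁻ V, ‖f (V⁻¹ * x)‖ₑ ^ (2 : ℝ) ∂ν ∂(haarChannel d)
      = ∫⁻ x, ‖f x‖ₑ ^ (2 : ℝ) ∂(haarChannel d) := by
  have hg : Measurable fun x => ‖f x‖ₑ ^ (2 : ℝ) := hf.measurable.enorm.pow_const _
  have hp := measurePreserving_inv_mul_prod ν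
  rw [← hp.lintegral_comp hg, lintegral_prod]
  exact (hg.comp hp.measurable).aemeasurable

theorem stronglyMeasurable_averagingFun {f : UnitaryChannel d → ℂ} (hf : StronglyMeasurable f) :
    StronglyMeasurable (averagingFun ν f) :=
  StronglyMeasurable.integral_prod_right' (f := fun p : UnitaryChannel d × UnitaryChannel d =>
    f (p.2⁻¹ * p.1)) (hf.comp_measurable (measurePreserving_inv_mul_prod ν).measurable)

theorem eLpNorm_averagingFun_le {f : UnitaryChannel d → ℂ} (hf : StronglyMeasurable f) :
    eLpNorm (averagingFun ν f) 2 (haarChannel d) ≤ eLpNorm f 2 (haarChannel d) := by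
  simp only [eLpNorm_eq_lintegral_rpow_enorm_toReal two_ne_zero ENNReal.ofNat_ne_top,
    ENNReal.toReal_ofNat]
  refine ENNReal.rpow_le_rpow ?_ (by positivity)
  rw [← lintegral_sq_translate ν hf]
  refine lintegral_mono fun x => ?_
  have h1 : ‖averagingFun ν f x‖ₑ ≤ eLpNorm (fun V => f (V⁻¹ * x)) 2 ν := by
    refine (enorm_integral_le_lintegral_enorm _).trans ?_
    rw [← eLpNorm_one_eq_lintegral_enorm]
    refine eLpNorm_le_eLpNorm_of_exponent_le (by norm_num) ?_
    exact (hf.comp_measurable (by fun_prop)).aestronglyMeasurable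
  refine (ENNReal.rpow_le_rpow h1 zero_le_two).trans ?_
  rw [eLpNorm_eq_lintegral_rpow_enorm_toReal two_ne_zero ENNReal.ofNat_ne_top,
    ← ENNReal.rpow_mul]
  simp

theorem memLp_averagingFun (f : Lp ℂ 2 (haarChannel d)) :
    MemLp (averagingFun ν f) 2 (haarChannel d) :=
  ⟨(stronglyMeasurable_averagingFun ν (Lp.stronglyMeasurable f)).aestronglyMeasurable,
    (eLpNorm_averagingFun_le ν (Lp.stronglyMeasurable f)).trans_lt (Lp.eLpNorm_lt_top f)⟩

theorem ae_integrable_translate (f : Lp ℂ 2 (haarChannel d)) :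
    ∀ᵐ x ∂(haarChannel d), Integrable (fun V => f (V⁻¹ * x)) ν := by
  have hf := Lp.stronglyMeasurable f
  have hp := measurePreserving_inv_mul_prod ν
  have h : Integrable (fun p : UnitaryChannel d × UnitaryChannel d => f (p.2⁻¹ * p.1))
      ((haarChannel d).prod ν) :=
    hp.integrable_comp_of_integrable ((Lp.memLp f).integrable one_le_two)
  exact h.prod_right_ae

theorem averagingFun_congr {f g : UnitaryChannel d → ℂ} (h : f =ᵐ[haarChannel d] g) :
    averagingFun ν f =ᵐ[haarChannel d] averagingFun ν g := by
  have hp := measurePreserving_inv_mul_prod ν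
  filter_upwards [Measure.ae_ae_of_ae_prod (hp.quasiMeasurePreserving.ae_eq_comp h)] with x hx
  exact integral_congr_ae hx

/-- The averaging operator `M_ν` on `L²` of the Haar measure,
`(M_ν f)(x) = ∫ f(V⁻¹ x) dν(V)`. -/
def averagingOperator : Lp ℂ 2 (haarChannel d) →L[ℂ] Lp ℂ 2 (haarChannel d) :=
  LinearMap.mkContinuous
    { toFun := fun f => (memLp_averagingFun ν f).toLp _
      map_add' := fun f g => by
        rw [← MemLp.toLp_add, MemLp.toLp_eq_toLp_iff]
        filter_upwards [averagingFun_congr ν (Lp.coeFn_add f g), ae_integrable_translate ν f,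
          ae_integrable_translate ν g] with x hx hf hg
        rw [hx]
        exact integral_add hf hg
      map_smul' := fun c f => by
        rw [RingHom.id_apply, ← MemLp.toLp_const_smul, MemLp.toLp_eq_toLp_iff]
        filter_upwards [averagingFun_congr ν (Lp.coeFn_smul c f)] with x hx
        rw [hx]
        exact integral_smul c _ }
    1 fun f => by
      rw [one_mul]
      change ‖(memLp_averagingFun ν f).toLp _‖ ≤ ‖f‖
      rw [Lp.norm_toLp, Lp.norm_def]
      exact ENNReal.toReal_mono (Lp.eLpNorm_ne_top f)
        (eLpNorm_averagingFun_le ν (Lp.stronglyMeasurable f))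

end Averaging

/-- Pure states: rank-one projectors `|v⟩⟨v|` onto unit vectors `v` of `ℂᵈ`. -/
def PureState (d : ℕ) : Type :=
  {ρ : Matrix (Fin d) (Fin d) ℂ //
    ∃ v : Fin d → ℂ, star v ⬝ᵥ v = 1 ∧ ρ = Matrix.vecMulVec v (star v)}

instance PureState.instTopologicalSpace (d : ℕ) : TopologicalSpace (PureState d) :=
  inferInstanceAs (TopologicalSpace (Subtype _))

instance PureState.instMeasurableSpace (d : ℕ) : MeasurableSpace (PureState d) := borel _

instance PureState.instBorelSpace (d : ℕ) : BorelSpace (PureState d) := ⟨rfl⟩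

/-- The trace norm `‖A‖₁ = tr √(A† A)`: the sum of the square roots of the eigenvalues
of `A† A`. -/
def traceNorm {d : ℕ} (A : Matrix (Fin d) (Fin d) ℂ) : ℝ :=
  ∑ i, √((Matrix.isHermitian_conjTranspose_mul_self A).eigenvalues i)

/-- The trace distance of two pure states. -/
def stateDist {d : ℕ} (ρ σ : PureState d) : ℝ :=
  1 / 2 * traceNorm (ρ.1 - σ.1)

/-- The closed ball of radius `r` around a pure state. -/
def stateBall {d : ℕ} (ψ : PureState d) (r : ℝ) : Set (PureState d) :=
  {φ | stateDist φ ψ ≤ r}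

/-- The action `ψ ↦ 𝒰(ψ) = U ψ U†` of unitary channels on pure states. -/
def UnitaryChannel.apply {d : ℕ} (x : UnitaryChannel d) (ψ : PureState d) : PureState d :=
  ⟨x.toAut ψ.1, by
    obtain ⟨v, hv, hρ⟩ := ψ.2
    induction x using QuotientGroup.induction_on with
    | H U =>
      refine ⟨(U : Matrix (Fin d) (Fin d) ℂ) *ᵥ v, ?_, ?_⟩
      · rw [Matrix.star_mulVec, Matrix.dotProduct_mulVec, Matrix.vecMul_vecMul,
          ← Matrix.star_eq_conjTranspose, Unitary.star_mul_self_of_mem U.2, Matrix.vecMul_one, hv]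
      · change (U : Matrix (Fin d) (Fin d) ℂ) * ψ.1 * star (U : Matrix (Fin d) (Fin d) ℂ) = _
        rw [hρ, Matrix.star_mulVec, Matrix.mul_vecMulVec, Matrix.vecMulVec_mul]
        rfl⟩

theorem UnitaryChannel.measurable_apply {d : ℕ} (ψ : PureState d) :
    Measurable fun x : UnitaryChannel d => x.apply ψ := by
  refine Continuous.measurable ?_
  have h : Continuous fun x : UnitaryChannel d => x.toAut ψ.1 := by
    refine QuotientGroup.isOpenQuotientMap_mk.isQuotientMap.continuous_iff.2 ?_
    change Continuous fun U : Matrix.unitaryGroup (Fin d) ℂ =>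
      (U : Matrix (Fin d) (Fin d) ℂ) * ψ.1 * star (U : Matrix (Fin d) (Fin d) ℂ)
    fun_prop
  exact h.subtype_mk _

/-- The measure on pure states induced by a measure on unitary channels and a reference state:
the law of `𝒰(φ₀)`. -/
def inducedMeasure {d : ℕ} (φ₀ : PureState d) (ν : Measure (UnitaryChannel d)) :
    Measure (PureState d) :=
  ν.map fun x => x.apply φ₀

/-- The pure state `|0⟩⟨0|`. -/
def basisState (d : ℕ) [NeZero d] : PureState d :=
  ⟨Matrix.vecMulVec (Pi.single 0 1) (star (Pi.single 0 1)), Pi.single 0 1, by simp, rfl⟩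

/-- The uniform measure on pure states. -/
def haarState (d : ℕ) [NeZero d] : Measure (PureState d) :=
  inducedMeasure (basisState d) (haarChannel d)

/-- The volume of a ball of radius `r` in the set of pure states. -/
def stateVol (d : ℕ) [NeZero d] (r : ℝ) : ℝ :=
  (haarState d).real (stateBall (basisState d) r)

/-- A probability measure on pure states is `(α, β)`-equidistributed at scale `ε`. -/
def IsStateEquidistributed {d : ℕ} [NeZero d] (ξ : Measure (PureState d)) (α β ε : ℝ) : Prop :=
  ∀ (ψ : PureState d) (R : ℝ), ε ≤ R →
    stateVol d (α * R) ≤ ξ.real (stateBall ψ R) ∧ ξ.real (stateBall ψ R) ≤ stateVol d (β * R)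

/-- The factor `min {((β-1)³/(β+1))^{1/2}, ((1-α)³/(1+α))^{1/2}}`. -/
def equidistributionFactor (α β : ℝ) : ℝ :=
  min (√((β - 1) ^ 3 / (β + 1))) (√((1 - α) ^ 3 / (1 + α)))

/-- The constant `c^{3/2} / (4 C^{1/2}) · √(2/3)` obtained from volume constants `c` and `C`. -/
def channelConstant (c C : ℝ) : ℝ :=
  c ^ (3 / 2 : ℝ) / (4 * C ^ (1 / 2 : ℝ)) * √(2 / 3)

/-- The constant `1/4 · √(2/3)`. -/
def stateConstant : ℝ := 1 / 4 * √(2 / 3)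

end

/-! Both halves are instances of one statement about a continuous length function `N` on the group,
with balls `{y | N (x⁻¹ * y) ≤ r}`; `N` may vanish away from `1`. For channels `N` is the distance
to the identity. For states it is the displacement of the reference state, so state balls pull back
to `N`-balls.

The operator `M_ν` sends the indicator of the `s`-ball at `1` to `x ↦ ν(B(x,s))`. Pairing with the
indicator of `B(x,t)`, comparing with `M_μ` and applying Cauchy–Schwarz shows that the integral of
`ν(B(y,s))` over `B(x,t)` differs from `Vol(t) Vol(s)` by at most `δ √(Vol(t) Vol(s))`, where `δ =
‖M_ν - M_μ‖`. As `B(x,R) ⊆ B(y,R+t)` for `y ∈ B(x,t)`, this gives `ν(B(x,R)) ≤ Vol(R+t) + δ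
√(Vol(R+t)/Vol(t))`, and a lower bound with `R-t` likewise (`IsLength.ball_le`, `IsLength.le_ball`).
With `t = (β-1)R/2` the error must fit into the volume of the shell between the radii `(β+1)R/2` and
`βR`. This comparison produces the factor `((β-1)³/(β+1))^{1/2}` (`IsLength.equidistributed`).

The remaining input is volume. For channels, the exponential chart on traceless Hermitian matrices
gives two-sided power bounds, and connectedness puts a ball inside each shell. For states, a
Gaussian integral gives `Vol_S(r) = r^{2(d-1)}` exactly for `0 < r < 1` (`stateVol_eq_pow`), and
shells are handled by superadditivity of powers. -/

noncomputable section

/-! ### Length functions and the spectral-gap estimate for balls. -/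

/-- A continuous length function on the group of unitary channels. -/
structure IsLength {d : ℕ} (N : UnitaryChannel d → ℝ) : Prop where
  continuous : Continuous N
  one : N 1 = 0
  inv : ∀ x, N x⁻¹ = N x
  mul_le : ∀ x y, N (x * y) ≤ N x + N y

/-- Haar volume of the closed ball defined by a length function. -/
def lengthVol {d : ℕ} (N : UnitaryChannel d → ℝ) (r : ℝ) : ℝ :=
  (haarChannel d).real {x | N x ≤ r}

/-- A right translate of Haar measure is again a Haar probability measure, so uniqueness on the
compact group applies. -/
instance haarChannel.instIsMulRightInvariant (d : ℕ) : (haarChannel d).IsMulRightInvariant := by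
  refine ⟨fun g => ?_⟩
  have : IsProbabilityMeasure ((haarChannel d).map (· * g)) :=
    Measure.isProbabilityMeasure_map (by fun_prop)
  exact Measure.isHaarMeasure_eq_of_isProbabilityMeasure _ _

theorem haarChannel_real_mul_left {d : ℕ} (g : UnitaryChannel d) (s : Set (UnitaryChannel d)) :
    (haarChannel d).real {x | g * x ∈ s} = (haarChannel d).real s :=
  congrArg ENNReal.toReal (measure_preimage_mul (haarChannel d) g s)

theorem haarChannel_real_mul_right {d : ℕ} (g : UnitaryChannel d) (s : Set (UnitaryChannel d)) :
    (haarChannel d).real {x | x * g ∈ s} = (haarChannel d).real s :=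
  congrArg ENNReal.toReal (measure_preimage_mul_right (haarChannel d) g s)

theorem lengthVol_ball {d : ℕ} (N : UnitaryChannel d → ℝ) (x : UnitaryChannel d) (r : ℝ) :
    (haarChannel d).real {y | N (x⁻¹ * y) ≤ r} = lengthVol N r :=
  haarChannel_real_mul_left x⁻¹ {y | N y ≤ r}

theorem lengthVol_mono {d : ℕ} (N : UnitaryChannel d → ℝ) {r s : ℝ} (h : r ≤ s) :
    lengthVol N r ≤ lengthVol N s :=
  measureReal_mono fun _ hx => le_trans hx h

namespace IsLength

variable {d : ℕ} {N : UnitaryChannel d → ℝ} (hN : IsLength N)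
include hN

theorem symm (x y : UnitaryChannel d) : N (x⁻¹ * y) = N (y⁻¹ * x) := by
  rw [← hN.inv]; simp

theorem triangle (x y z : UnitaryChannel d) : N (x⁻¹ * z) ≤ N (x⁻¹ * y) + N (y⁻¹ * z) := by
  have := hN.mul_le (x⁻¹ * y) (y⁻¹ * z)
  rwa [mul_assoc, mul_inv_cancel_left] at this

theorem measurableSet_ball (x : UnitaryChannel d) (r : ℝ) :
    MeasurableSet {y | N (x⁻¹ * y) ≤ r} :=
  (isClosed_le (hN.continuous.comp (by fun_prop)) continuous_const).measurableSet

theorem measurableSet_ball_one (r : ℝ) : MeasurableSet {y | N y ≤ r} :=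
  (isClosed_le hN.continuous continuous_const).measurableSet

theorem vol_pos {r : ℝ} (hr : 0 < r) : 0 < lengthVol N r := by
  have h : IsOpen {x | N x < r} := isOpen_lt hN.continuous continuous_const
  have h1 : 0 < (haarChannel d) {x | N x ≤ r} :=
    (h.measure_pos (haarChannel d) ⟨1, by simpa [hN.one] using hr⟩).trans_le
      (measure_mono fun x (hx : N x < r) => hx.le)
  exact ENNReal.toReal_pos h1.ne' (measure_ne_top _ _)

/-- The symmetry `N (V⁻¹ * x) = N (x⁻¹ * V)` turns the translated indicator into that of a ball
around `x`. -/
theorem averagingFun_ball (ν : Measure (UnitaryChannel d)) [IsProbabilityMeasure ν] (s : ℝ)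
    (x : UnitaryChannel d) :
    averagingFun ν ({y | N y ≤ s}.indicator fun _ => (1 : ℂ)) x
      = (ν.real {y | N (x⁻¹ * y) ≤ s} : ℂ) := by
  have : (fun V => {y | N y ≤ s}.indicator (fun _ => (1 : ℂ)) (V⁻¹ * x))
      = {y | N (x⁻¹ * y) ≤ s}.indicator fun _ => (1 : ℂ) := by
    ext V
    simp only [Set.indicator, Set.mem_ofPred_eq, hN.symm V x]
  rw [averagingFun, this, integral_indicator_const _ (hN.measurableSet_ball x s)]
  simp

theorem inner_averagingOperator (ν : Measure (UnitaryChannel d)) [IsProbabilityMeasure ν]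
    {S : Set (UnitaryChannel d)} (hS : MeasurableSet S) (s : ℝ) :
    inner ℂ (indicatorConstLp 2 hS (measure_ne_top (haarChannel d) S) (1 : ℂ))
      (averagingOperator ν (indicatorConstLp 2 (hN.measurableSet_ball_one s)
        (measure_ne_top (haarChannel d) _) (1 : ℂ)))
      = ((∫ x in S, ν.real {y | N (x⁻¹ * y) ≤ s} ∂(haarChannel d) : ℝ) : ℂ) := by
  rw [L2.inner_indicatorConstLp_one, ← integral_complex_ofReal]
  refine integral_congr_ae (ae_restrict_of_ae ?_)
  have h1 := MemLp.coeFn_toLp (memLp_averagingFun ν (indicatorConstLp 2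
    (hN.measurableSet_ball_one s) (measure_ne_top (haarChannel d) _) (1 : ℂ)))
  have h2 := averagingFun_congr ν (indicatorConstLp_coeFn (p := 2)
    (hs := hN.measurableSet_ball_one s) (hμs := measure_ne_top (haarChannel d) _) (c := (1 : ℂ)))
  filter_upwards [h1, h2] with x hx hx'
  rw [← hN.averagingFun_ball, ← hx', ← hx]
  rfl

theorem integrable_ball (ν : Measure (UnitaryChannel d)) [IsProbabilityMeasure ν] (s : ℝ) :
    Integrable (fun x => ν.real {y | N (x⁻¹ * y) ≤ s}) (haarChannel d) := by
  have h1 : StronglyMeasurable fun x => (ν.real {y | N (x⁻¹ * y) ≤ s} : ℂ) := by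
    have := stronglyMeasurable_averagingFun ν
      (stronglyMeasurable_const.indicator (hN.measurableSet_ball_one s) (β := ℂ) (f := fun _ => 1))
    convert this using 1
    ext x
    rw [hN.averagingFun_ball]
  have h2 : Measurable fun x => ν.real {y | N (x⁻¹ * y) ≤ s} :=
    Complex.measurable_re.comp h1.measurable
  refine Integrable.of_bound h2.aestronglyMeasurable 1 (ae_of_all _ fun x => ?_)
  rw [Real.norm_of_nonneg measureReal_nonneg]
  exact measureReal_le_one

/-- Cauchy–Schwarz for `M_ν - M_μ` between two ball indicators, whose norms are square roots of
volumes. For Haar measure the integrand is constant, which gives the product of volumes. -/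
theorem abs_integral_sub_le (ν : Measure (UnitaryChannel d)) [IsProbabilityMeasure ν]
    (x : UnitaryChannel d) (s t : ℝ) :
    |(∫ y in {y | N (x⁻¹ * y) ≤ t}, ν.real {z | N (y⁻¹ * z) ≤ s} ∂(haarChannel d))
        - lengthVol N t * lengthVol N s|
      ≤ ‖averagingOperator ν - averagingOperator (haarChannel d)‖ *
        (√(lengthVol N t) * √(lengthVol N s)) := by
  have hS := hN.measurableSet_ball x t
  have e1 := hN.inner_averagingOperator ν hS s
  have e2 := hN.inner_averagingOperator (haarChannel d) hS s
  simp only [lengthVol_ball, setIntegral_const, smul_eq_mul] at e2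
  have hs := hN.measurableSet_ball_one s
  have n1 : ‖indicatorConstLp 2 hS (measure_ne_top (haarChannel d) _) (1 : ℂ)‖
      = √(lengthVol N t) := by
    rw [norm_indicatorConstLp two_ne_zero ENNReal.ofNat_ne_top, lengthVol_ball, Real.sqrt_eq_rpow]
    simp
  have n2 : ‖indicatorConstLp 2 hs (measure_ne_top (haarChannel d) _) (1 : ℂ)‖
      = √(lengthVol N s) := by
    rw [norm_indicatorConstLp two_ne_zero ENNReal.ofNat_ne_top, Real.sqrt_eq_rpow]
    simp [lengthVol]
  have key := (norm_inner_le_norm (𝕜 := ℂ)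
    (indicatorConstLp 2 hS (measure_ne_top (haarChannel d) _) (1 : ℂ))
    ((averagingOperator ν - averagingOperator (haarChannel d))
      (indicatorConstLp 2 hs (measure_ne_top (haarChannel d) _) (1 : ℂ)))).trans
    (mul_le_mul_of_nonneg_left (ContinuousLinearMap.le_opNorm _ _) (norm_nonneg _))
  rw [sub_apply, inner_sub_right, e1, e2, ← Complex.ofReal_sub,
    Complex.norm_real, Real.norm_eq_abs, n1, n2] at key
  linarith

/-- Every `y` within `t` of `x` satisfies `B(x,R) ⊆ B(y,R+t)`; averaging over such `y` and dividing
by `Vol(t)` gives the bound. -/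
theorem ball_le (ν : Measure (UnitaryChannel d)) [IsProbabilityMeasure ν]
    (x : UnitaryChannel d) (R : ℝ) {t : ℝ} (ht : 0 < t) :
    ν.real {y | N (x⁻¹ * y) ≤ R} ≤ lengthVol N (R + t)
      + ‖averagingOperator ν - averagingOperator (haarChannel d)‖ *
        √(lengthVol N (R + t) / lengthVol N t) := by
  have h := (abs_le.1 (hN.abs_integral_sub_le ν x (R + t) t)).2
  have hS := hN.measurableSet_ball x t
  have h1 : lengthVol N t * ν.real {y | N (x⁻¹ * y) ≤ R}
      ≤ ∫ y in {y | N (x⁻¹ * y) ≤ t}, ν.real {z | N (y⁻¹ * z) ≤ R + t} ∂(haarChannel d) := by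
    rw [← lengthVol_ball N x t, ← smul_eq_mul, ← setIntegral_const]
    refine setIntegral_mono_on (by simp) (hN.integrable_ball ν _).integrableOn hS fun y hy => ?_
    refine measureReal_mono fun z (hz : N (x⁻¹ * z) ≤ R) => ?_
    have := hN.triangle y x z
    have hy' : N (x⁻¹ * y) ≤ t := hy
    rw [hN.symm y x] at this
    exact this.trans (by linarith)
  have hp := hN.vol_pos ht
  have e : √(lengthVol N t) * √(lengthVol N (R + t))
      = lengthVol N t * √(lengthVol N (R + t) / lengthVol N t) := by
    rw [Real.sqrt_div' _ hp.le]
    field_simp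
    rw [Real.sq_sqrt hp.le, mul_comm]
  rw [e] at h
  refine le_of_mul_le_mul_left ?_ hp
  linarith

theorem le_ball (ν : Measure (UnitaryChannel d)) [IsProbabilityMeasure ν]
    (x : UnitaryChannel d) (R : ℝ) {t : ℝ} (ht : 0 < t) :
    lengthVol N (R - t) - ‖averagingOperator ν - averagingOperator (haarChannel d)‖ *
        √(lengthVol N (R - t) / lengthVol N t) ≤ ν.real {y | N (x⁻¹ * y) ≤ R} := by
  have h := (abs_le.1 (hN.abs_integral_sub_le ν x (R - t) t)).1
  have hS := hN.measurableSet_ball x t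
  have h1 : (∫ y in {y | N (x⁻¹ * y) ≤ t}, ν.real {z | N (y⁻¹ * z) ≤ R - t} ∂(haarChannel d))
      ≤ lengthVol N t * ν.real {y | N (x⁻¹ * y) ≤ R} := by
    rw [← lengthVol_ball N x t, ← smul_eq_mul, ← setIntegral_const]
    refine setIntegral_mono_on (hN.integrable_ball ν _).integrableOn (by simp) hS fun y hy => ?_
    refine measureReal_mono fun z (hz : N (y⁻¹ * z) ≤ R - t) => ?_
    have := hN.triangle x y z
    have hy' : N (x⁻¹ * y) ≤ t := hy
    exact this.trans (by linarith)
  have hp := hN.vol_pos ht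
  have e : √(lengthVol N t) * √(lengthVol N (R - t))
      = lengthVol N t * √(lengthVol N (R - t) / lengthVol N t) := by
    rw [Real.sqrt_div' _ hp.le]
    field_simp
    rw [Real.sq_sqrt hp.le, mul_comm]
  rw [e] at h
  refine le_of_mul_le_mul_left ?_ hp
  linarith

theorem tendsto_ball (ν : Measure (UnitaryChannel d)) [IsProbabilityMeasure ν]
    (x : UnitaryChannel d) (R : ℝ) :
    Filter.Tendsto (fun k : ℕ => ν.real {y | N (x⁻¹ * y) ≤ R + 1 / ((k : ℝ) + 1)}) Filter.atTop
      (nhds (ν.real {y | N (x⁻¹ * y) ≤ R})) := by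
  have e : {y | N (x⁻¹ * y) ≤ R} = ⋂ k : ℕ, {y | N (x⁻¹ * y) ≤ R + 1 / ((k : ℝ) + 1)} := by
    ext y
    simp only [Set.mem_ofPred_eq, Set.mem_iInter]
    constructor
    · intro h k
      have : (0 : ℝ) ≤ 1 / ((k : ℝ) + 1) := by positivity
      linarith
    · intro h
      have := tendsto_one_div_add_atTop_nhds_zero_nat (𝕜 := ℝ).const_add R
      rw [add_zero] at this
      exact ge_of_tendsto' this h
  have h := tendsto_measure_iInter_atTop (μ := ν)
    (s := fun k : ℕ => {y | N (x⁻¹ * y) ≤ R + 1 / ((k : ℝ) + 1)})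
    (fun k => (hN.measurableSet_ball x _).nullMeasurableSet)
    (fun i j hij y hy => le_trans hy
      (add_le_add_right (one_div_le_one_div_of_le (by positivity) (by gcongr)) R)) ⟨0, measure_ne_top _ _⟩
  rw [← e] at h
  exact (ENNReal.tendsto_toReal (measure_ne_top _ _)).comp h

/-- Without an error term the smoothing radius `t` can tend to zero. This covers `α = 1` and `β =
1`, where the shell is empty. -/
theorem ball_eq_of_norm_eq_zero (ν : Measure (UnitaryChannel d)) [IsProbabilityMeasure ν]
    (h0 : ‖averagingOperator ν - averagingOperator (haarChannel d)‖ = 0)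
    (x : UnitaryChannel d) (R : ℝ) :
    ν.real {y | N (x⁻¹ * y) ≤ R} = lengthVol N R := by
  have hk : ∀ k : ℕ, (0 : ℝ) < 1 / ((k : ℝ) + 1) := fun k => by positivity
  refine le_antisymm ?_ ?_
  · have h := hN.tendsto_ball (haarChannel d) x R
    simp only [lengthVol_ball] at h
    refine ge_of_tendsto' h fun k => ?_
    have := hN.ball_le ν x R (hk k)
    rwa [h0, zero_mul, add_zero] at this
  -- The lower bound is used at the enlarged radius, because measures of closed balls are continuous
  -- only from the right in the radius.
  · refine ge_of_tendsto' (hN.tendsto_ball ν x R) fun k => ?_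
    have := hN.le_ball ν x (R + 1 / ((k : ℝ) + 1)) (hk k)
    rwa [h0, zero_mul, sub_zero, add_sub_cancel_right] at this

end IsLength

/-! ### From ball estimates to equidistribution. -/

/-- The root of the volume ratio is at most `√(s/t) ^ n`, which the factor `√(t/s)` in the rate `p`
cancels. -/
theorem mul_sqrt_div_le_pow {n : ℕ} {p q t s vt vs δ : ℝ} (ht : 0 < t) (hs : 0 < s)
    (hvt : t ^ n ≤ vt) (hvs : vs ≤ s ^ n) (hp0 : 0 ≤ p) (hp : p ≤ q * √(t / s))
    (hδ : δ ≤ p ^ n) : δ * √(vs / vt) ≤ q ^ n := by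
  have h1 : √(vs / vt) ≤ √(s / t) ^ n := by
    refine Real.sqrt_le_iff.2 ⟨by positivity, ?_⟩
    rw [← pow_mul, mul_comm, pow_mul, Real.sq_sqrt (by positivity), div_pow]
    exact div_le_div₀ (by positivity) hvs (by positivity) hvt
  have h2 : √(t / s) * √(s / t) = 1 := by
    rw [← Real.sqrt_mul (by positivity), div_mul_div_cancel₀ hs.ne', div_self ht.ne', Real.sqrt_one]
  calc δ * √(vs / vt) ≤ p ^ n * √(s / t) ^ n := by gcongr
    _ = (p * √(s / t)) ^ n := (mul_pow _ _ _).symm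
    _ ≤ q ^ n := by
      refine pow_le_pow_left₀ (by positivity) ?_ n
      calc p * √(s / t) ≤ q * √(t / s) * √(s / t) := by gcongr
        _ = q := by rw [mul_assoc, h2, mul_one]

/-- Origin of the constants: `a * R / 2` is both the smoothing radius and the shell width, `b * R /
2` is the smoothed radius, and `a √(a/b) = √(a³/b)`. Here `(a, b)` is `(β-1, β+1)` or `(1-α, 1+α)`.
-/
theorem rate_le {a b c C κ ε R m : ℝ} (ha : 0 < a) (hb : 0 < b) (hc : 0 < c) (hC : 0 < C)
    (hκ : 0 < κ) (hε : 0 < ε) (hR : ε ≤ R) (hm0 : 0 ≤ m) (hm : m ≤ √(a ^ 3 / b)) :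
    c ^ (3 / 2 : ℝ) / C ^ (1 / 2 : ℝ) * (κ / 2) * ε * m
      ≤ c * κ * (a * R / 2) * √(c * (a * R / 2) / (C * (b * R / 2))) := by
  have hR0 : 0 < R := hε.trans_le hR
  have e1 : c ^ (3 / 2 : ℝ) = c * √c := by
    rw [Real.sqrt_eq_rpow, ← Real.rpow_one_add' hc.le (by norm_num)]
    norm_num
  have e2 : √(a ^ 3 / b) = a * √(a / b) := by
    rw [show a ^ 3 / b = a ^ 2 * (a / b) by ring, Real.sqrt_mul (by positivity), Real.sqrt_sq ha.le]
  have e3 : √(c * (a * R / 2) / (C * (b * R / 2))) = √c / √C * √(a / b) := by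
    rw [show c * (a * R / 2) / (C * (b * R / 2)) = c / C * (a / b) by field_simp,
      Real.sqrt_mul (by positivity), Real.sqrt_div hc.le]
  rw [e1, e3, ← Real.sqrt_eq_rpow]
  rw [e2] at hm
  have hC' : 0 < √C := Real.sqrt_pos.2 hC
  calc c * √c / √C * (κ / 2) * ε * m ≤ c * √c / √C * (κ / 2) * R * (a * √(a / b)) := by gcongr
    _ = _ := by ring

/-- Volume bounds are assumed only below the diameter, since larger balls are the whole group. The
constant `κ` measures the loss in the shell estimate. For `n = 0` the norm bound carries no
information, so `hn` asks that `N` vanish. -/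
theorem IsLength.equidistributed {d : ℕ} {N : UnitaryChannel d → ℝ} (hN : IsLength N) {n : ℕ}
    {c C κ ε m α β : ℝ} (hc : 0 < c) (hC : 0 < C) (hκ : 0 < κ) (hε : 0 < ε) (hm0 : 0 ≤ m)
    (hα : 0 < α) (hα1 : α ≤ 1) (hβ : 1 ≤ β)
    (hvol : ∀ r, 0 < r → (∃ z, r < N z) →
      (c * r) ^ n ≤ lengthVol N r ∧ lengthVol N r ≤ (C * r) ^ n)
    (hshell : ∀ s b, 0 < s → s < b → (∃ z, b < N z) →
      (c * κ * (b - s)) ^ n ≤ lengthVol N b - lengthVol N s)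
    (hn : n = 0 → ∀ z, N z = 0)
    (hmβ : m ≤ √((β - 1) ^ 3 / (β + 1))) (hmα : m ≤ √((1 - α) ^ 3 / (1 + α)))
    (ν : Measure (UnitaryChannel d)) [IsProbabilityMeasure ν]
    (hδ : ‖averagingOperator ν - averagingOperator (haarChannel d)‖
      ≤ (c ^ (3 / 2 : ℝ) / C ^ (1 / 2 : ℝ) * (κ / 2) * ε * m) ^ n)
    (x : UnitaryChannel d) {R : ℝ} (hR : ε ≤ R) :
    lengthVol N (α * R) ≤ ν.real {y | N (x⁻¹ * y) ≤ R} ∧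
      ν.real {y | N (x⁻¹ * y) ≤ R} ≤ lengthVol N (β * R) := by
  have hR0 : 0 < R := hε.trans_le hR
  set δ := ‖averagingOperator ν - averagingOperator (haarChannel d)‖ with hδdef
  rcases (norm_nonneg _ : 0 ≤ δ).eq_or_lt with h0 | hpos
  · rw [hN.ball_eq_of_norm_eq_zero ν h0.symm]
    exact ⟨lengthVol_mono N (by nlinarith), lengthVol_mono N (by nlinarith)⟩
  have hm : n ≠ 0 → 0 < m := by
    intro hn'
    refine hm0.lt_of_ne fun h => ?_
    rw [← h, mul_zero, zero_pow hn'] at hδ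
    linarith
  constructor
  · by_cases hbig : ∀ z, N z ≤ R
    · have : ν.real {y | N (x⁻¹ * y) ≤ R} = 1 := by simp [hbig]
      rw [this]
      exact measureReal_le_one
    push Not at hbig
    obtain ⟨z, hz⟩ := hbig
    have hn0 : n ≠ 0 := fun h => by rw [hn h z] at hz; linarith
    have ha : 0 < 1 - α := by
      refine (sub_nonneg.2 hα1).lt_of_ne fun h => ?_
      rw [← h] at hmα
      exact absurd hmα (by simpa using hm hn0)
    -- With this smoothing radius, `R - t` is the midpoint of `α * R` and `R`, so the remaining
    -- shell also has width `t`.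
    have ht : 0 < (1 - α) * R / 2 := by positivity
    have hs : 0 < (1 + α) * R / 2 := by positivity
    have es : R - (1 - α) * R / 2 = (1 + α) * R / 2 := by ring
    have h1 := hN.le_ball ν x R ht
    rw [es] at h1
    have h2 := hshell (α * R) ((1 + α) * R / 2) (by positivity) (by linarith) ⟨z, by linarith⟩
    rw [show (1 + α) * R / 2 - α * R = (1 - α) * R / 2 by ring] at h2
    have h3 := mul_sqrt_div_le_pow (mul_pos hc ht) (mul_pos hC hs)
      (hvol _ ht ⟨z, by nlinarith⟩).1 (hvol _ hs ⟨z, by linarith⟩).2 (by positivity)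
      (rate_le ha (by linarith) hc hC hκ hε hR hm0 hmα) hδ
    linarith
  · by_cases hbig : ∀ z, N z ≤ β * R
    · have : lengthVol N (β * R) = 1 := by simp [lengthVol, hbig]
      rw [this]
      exact measureReal_le_one
    push Not at hbig
    obtain ⟨z, hz⟩ := hbig
    have hn0 : n ≠ 0 := fun h => by rw [hn h z] at hz; nlinarith
    have ha : 0 < β - 1 := by
      refine (sub_nonneg.2 hβ).lt_of_ne fun h => ?_
      rw [← h] at hmβ
      exact absurd hmβ (by simpa using hm hn0)
    have ht : 0 < (β - 1) * R / 2 := by positivity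
    have hs : 0 < (β + 1) * R / 2 := by positivity
    have es : R + (β - 1) * R / 2 = (β + 1) * R / 2 := by ring
    have h1 := hN.ball_le ν x R ht
    rw [es] at h1
    have h2 := hshell ((β + 1) * R / 2) (β * R) hs (by linarith) ⟨z, hz⟩
    rw [show β * R - (β + 1) * R / 2 = (β - 1) * R / 2 by ring] at h2
    have h3 := mul_sqrt_div_le_pow (mul_pos hc ht) (mul_pos hC hs)
      (hvol _ ht ⟨z, by linarith⟩).1 (hvol _ hs ⟨z, by linarith⟩).2 (by positivity)
      (rate_le ha (by linarith) hc hC hκ hε hR hm0 hmβ) hδ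
    linarith

/-- Lower bound for the volume of a shell, when a shell contains a ball. -/
theorem IsLength.shell_of_connected {d : ℕ} {N : UnitaryChannel d → ℝ} (hN : IsLength N)
    [PreconnectedSpace (UnitaryChannel d)] {n : ℕ} {c : ℝ}
    (hvol : ∀ r, 0 < r → (∃ z, r < N z) → (c * r) ^ n ≤ lengthVol N r)
    {s b : ℝ} (hs : 0 < s) (hsb : s < b) (hb : ∃ z, b < N z) :
    (c * (1 / 2) * (b - s)) ^ n ≤ lengthVol N b - lengthVol N s := by
  obtain ⟨z, hz⟩ := hb
  -- By connectedness `N` attains the middle of the shell.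
  obtain ⟨y, hy⟩ : ∃ y, N y = (s + b) / 2 :=
    mem_range_of_exists_le_of_exists_ge hN.continuous ⟨1, by rw [hN.one]; linarith⟩
      ⟨z, by linarith⟩
  -- A radius strictly below half the width keeps the ball around `y` disjoint from the closed ball
  -- of radius `s`; the endpoint follows by a limit.
  have key : ∀ u, 0 < u → u < (b - s) / 2 → (c * u) ^ n ≤ lengthVol N b - lengthVol N s := by
    intro u hu hu'
    refine (hvol u hu ⟨z, by linarith⟩).trans ?_
    rw [← lengthVol_ball N y u, le_sub_iff_add_le, lengthVol, lengthVol,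
      ← measureReal_union ?_ (hN.measurableSet_ball_one s)]
    · refine measureReal_mono ?_
      rintro w (hw | hw)
      · have h1 := hN.triangle 1 y w
        simp only [inv_one, one_mul] at h1
        have hw' : N (y⁻¹ * w) ≤ u := hw
        exact h1.trans (by linarith)
      · exact le_trans hw hsb.le
    · rw [Set.disjoint_left]
      intro w hw hw2
      have h1 := hN.triangle 1 w y
      simp only [inv_one, one_mul] at h1
      rw [hN.symm w y] at h1
      have hw' : N (y⁻¹ * w) ≤ u := hw
      have hw2' : N w ≤ s := hw2
      linarith
  have hlim : Filter.Tendsto (fun u : ℝ => (c * u) ^ n) (nhdsWithin ((b - s) / 2)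
      (Set.Iio ((b - s) / 2))) (nhds ((c * ((b - s) / 2)) ^ n)) :=
    (Continuous.tendsto (by fun_prop) _).mono_left nhdsWithin_le_nhds
  rw [show c * (1 / 2) * (b - s) = c * ((b - s) / 2) by ring]
  refine le_of_tendsto hlim ?_
  filter_upwards [Ioo_mem_nhdsLT (show (0 : ℝ) < (b - s) / 2 by linarith)] with u hu
  exact key u hu.1 hu.2

/-! ### Ball volumes from Lipschitz charts. -/

namespace IsLength

variable {d : ℕ} {N : UnitaryChannel d → ℝ} (hN : IsLength N)
  {E : Type*} [NormedAddCommGroup E] [NormedSpace ℝ E] [FiniteDimensional ℝ E]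
include hN

/-- Tonelli on pairs `(A, x)`: for fixed `A` the slice is a translated `N`-ball. The two chart
lemmas bound the other slices by balls of `E`. -/
theorem lintegral_slice [MeasurableSpace E] [BorelSpace E] (lam : Measure E)
    [lam.IsAddHaarMeasure] {e : E → UnitaryChannel d} (he : Continuous e) (ρ r : ℝ) :
    ∫⁻ x, lam {A | ‖A‖ ≤ ρ ∧ N (x⁻¹ * e A) ≤ r} ∂(haarChannel d)
      = lam (Metric.closedBall 0 ρ) * haarChannel d {x | N x ≤ r} := by
  have hW : MeasurableSet {p : E × UnitaryChannel d | ‖p.1‖ ≤ ρ ∧ N (p.2⁻¹ * e p.1) ≤ r} := by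
    refine IsClosed.measurableSet (IsClosed.inter ?_ ?_)
    · exact isClosed_le (continuous_fst.norm) continuous_const
    · exact isClosed_le (hN.continuous.comp (by fun_prop)) continuous_const
  have h1 := Measure.prod_apply_symm (μ := lam) (ν := haarChannel d) hW
  rw [Measure.prod_apply hW] at h1
  refine h1.symm.trans ?_
  have h2 : ∀ A : E, haarChannel d (Prod.mk A ⁻¹'
      {p : E × UnitaryChannel d | ‖p.1‖ ≤ ρ ∧ N (p.2⁻¹ * e p.1) ≤ r})
      = (Metric.closedBall 0 ρ).indicator (fun _ => haarChannel d {x | N x ≤ r}) A := by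
    intro A
    by_cases hA : ‖A‖ ≤ ρ
    · rw [Set.indicator_of_mem (by simpa using hA),
        ← measure_preimage_mul (haarChannel d) (e A)⁻¹ {x | N x ≤ r}]
      congr 1
      ext x
      simp [hA, hN.symm x]
    · rw [Set.indicator_of_notMem (by simpa using hA)]
      simp [hA]
  simp_rw [h2]
  rw [lintegral_indicator_const Metric.isClosed_closedBall.measurableSet, mul_comm]

theorem vol_le_of_chart {e : E → UnitaryChannel d} (he : Continuous e) {ρ κ r : ℝ} (hρ : 0 < ρ)
    (hκ : 0 < κ) (hr : 0 < r)
    (h : ∀ A B, ‖A‖ ≤ ρ → ‖B‖ ≤ ρ → ‖A - B‖ ≤ κ * N ((e B)⁻¹ * e A)) :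
    lengthVol N r ≤ (2 * κ / ρ * r) ^ Module.finrank ℝ E := by
  borelize E
  obtain ⟨lam, _⟩ : ∃ lam : Measure E, lam.IsAddHaarMeasure := ⟨Measure.addHaar, inferInstance⟩
  have key : lam (Metric.closedBall 0 ρ) * haarChannel d {x | N x ≤ r}
      ≤ lam (Metric.closedBall 0 (2 * κ * r)) := by
    rw [← hN.lintegral_slice lam he]
    refine (lintegral_mono (g := fun _ => lam (Metric.closedBall 0 (2 * κ * r)))
      fun x => ?_).trans (by simp)
    -- Two points of a slice have images within `2r` of each other, so the slice lies in the ball of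
    -- radius `2κr` around any of its points.
    rcases Set.eq_empty_or_nonempty {A | ‖A‖ ≤ ρ ∧ N (x⁻¹ * e A) ≤ r} with h0 | ⟨B, hB, hB'⟩
    · simp [h0]
    rw [← Measure.addHaar_closedBall_center lam B]
    refine measure_mono fun A hA => ?_
    have h1 := h A B hA.1 hB
    have h2 := hN.triangle (e B) x (e A)
    rw [hN.symm (e B) x] at h2
    rw [Metric.mem_closedBall, dist_eq_norm]
    have := hA.2
    nlinarith
  rw [Measure.addHaar_closedBall _ _ hρ.le, Measure.addHaar_closedBall _ _ (by positivity)] at key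
  have key2 := ENNReal.toReal_mono (by finiteness) key
  rw [ENNReal.toReal_mul, ENNReal.toReal_mul, ENNReal.toReal_mul,
    ENNReal.toReal_ofReal (by positivity), ENNReal.toReal_ofReal (by positivity)] at key2
  have hpos : 0 < (lam (Metric.ball 0 1)).toReal :=
    ENNReal.toReal_pos (Metric.measure_ball_pos lam 0 one_pos).ne' measure_ball_lt_top.ne
  have key3 : ρ ^ Module.finrank ℝ E * lengthVol N r ≤ (2 * κ * r) ^ Module.finrank ℝ E := by
    refine le_of_mul_le_mul_right ?_ hpos
    calc _ = _ := by rw [lengthVol, Measure.real, mul_right_comm]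
      _ ≤ _ := key2
  rw [show 2 * κ / ρ * r = 2 * κ * r / ρ by ring, div_pow, le_div_iff₀ (by positivity)]
  linarith

/-- Writing `x = e B` with `‖B‖ ≤ K`, the slice at `x` contains the `r`-ball around `B`, which stays
inside the ball of radius `K + r`. -/
theorem le_vol_of_chart {e : E → UnitaryChannel d} (he : Continuous e) {K r : ℝ} (hK : 0 ≤ K)
    (hr : 0 < r) (hsurj : ∀ x, ∃ A, ‖A‖ ≤ K ∧ e A = x)
    (h : ∀ A B, N ((e B)⁻¹ * e A) ≤ ‖A - B‖) :
    (r / (K + r)) ^ Module.finrank ℝ E ≤ lengthVol N r := by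
  borelize E
  obtain ⟨lam, _⟩ : ∃ lam : Measure E, lam.IsAddHaarMeasure := ⟨Measure.addHaar, inferInstance⟩
  have key : lam (Metric.closedBall 0 r)
      ≤ lam (Metric.closedBall 0 (K + r)) * haarChannel d {x | N x ≤ r} := by
    rw [← hN.lintegral_slice lam he]
    refine le_trans (by simp) (lintegral_mono (f := fun _ => lam (Metric.closedBall 0 r))
      fun x => ?_)
    obtain ⟨B, hB, rfl⟩ := hsurj x
    rw [← Measure.addHaar_closedBall_center lam B]
    refine measure_mono fun A hA => ?_
    rw [Metric.mem_closedBall, dist_eq_norm] at hA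
    refine ⟨?_, (h A B).trans hA⟩
    calc ‖A‖ = ‖B + (A - B)‖ := by rw [add_sub_cancel]
      _ ≤ K + r := (norm_add_le _ _).trans (add_le_add hB hA)
  rw [Measure.addHaar_closedBall _ _ hr.le, Measure.addHaar_closedBall _ _ (by positivity)] at key
  have key2 := ENNReal.toReal_mono (by finiteness) key
  rw [ENNReal.toReal_mul, ENNReal.toReal_mul, ENNReal.toReal_mul,
    ENNReal.toReal_ofReal (by positivity), ENNReal.toReal_ofReal (by positivity)] at key2
  have hpos : 0 < (lam (Metric.ball 0 1)).toReal :=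
    ENNReal.toReal_pos (Metric.measure_ball_pos lam 0 one_pos).ne' measure_ball_lt_top.ne
  have key3 : r ^ Module.finrank ℝ E ≤ lengthVol N r * (K + r) ^ Module.finrank ℝ E := by
    refine le_of_mul_le_mul_right ?_ hpos
    calc _ ≤ _ := key2
      _ = _ := by rw [lengthVol, Measure.real]; ring
  rwa [div_pow, div_le_iff₀ (by positivity)]

end IsLength

/-! ### Lipschitz estimates for the unitary exponential. -/

section Exponential

open NormedSpace selfAdjoint

variable {A : Type*} [CStarAlgebra A]

theorem norm_unitary_le_one (u : unitary A) : ‖(u : A)‖ ≤ 1 := by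
  nontriviality A
  exact (CStarRing.norm_coe_unitary u).le

theorem norm_exp_smul_I_smul_le_one (a : selfAdjoint A) (t : ℝ) :
    ‖exp (t • (Complex.I • (a : A)))‖ ≤ 1 := by
  have : exp (t • (Complex.I • (a : A))) = (expUnitary (t • a) : A) := by
    rw [expUnitary_coe, smul_comm]
    rfl
  rw [this]
  exact norm_unitary_le_one _

/-- Duhamel interpolation: this path joins `exp Y` to `exp X`, and for skew-adjoint `X`, `Y` its
derivative has norm at most `‖X - Y‖`. -/
theorem hasDerivAt_exp_mul_exp (X Y : A) (t : ℝ) :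
    HasDerivAt (fun s : ℝ => exp (s • X) * exp ((1 - s) • Y))
      (exp (t • X) * (X - Y) * exp ((1 - t) • Y)) t := by
  have h1 : HasDerivAt (fun s : ℝ => exp (s • X)) (exp (t • X) * X) t :=
    hasDerivAt_exp_smul_const X t
  have h2 : HasDerivAt (fun s : ℝ => exp ((1 - s) • Y)) ((-1 : ℝ) • (Y * exp ((1 - t) • Y))) t :=
    (hasDerivAt_exp_smul_const' Y (1 - t)).scomp t ((hasDerivAt_id t).const_sub 1)
  convert HasDerivAt.fun_mul h1 h2 using 1
  rw [neg_smul, one_smul, mul_neg, mul_sub, sub_mul, mul_assoc _ Y, sub_eq_add_neg]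

theorem norm_expUnitary_sub_le (a b : selfAdjoint A) :
    ‖(expUnitary a - expUnitary b : A)‖ ≤ ‖a - b‖ := by
  have h := norm_image_sub_le_of_norm_deriv_le_segment_01' (C := ‖a - b‖)
    (fun t _ => (hasDerivAt_exp_mul_exp (Complex.I • (a : A)) (Complex.I • (b : A))
      t).hasDerivWithinAt) (fun t _ => ?_)
  · simpa using h
  · refine (norm_mul_le _ _).trans ((mul_le_of_le_one_right (norm_nonneg _)
      (norm_exp_smul_I_smul_le_one b _)).trans ((norm_mul_le _ _).trans
      ((mul_le_of_le_one_left (norm_nonneg _) (norm_exp_smul_I_smul_le_one a _)).trans ?_)))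
    rw [← smul_sub, norm_smul, Complex.norm_I, one_mul]
    rfl

theorem norm_exp_smul_sub_one_le (a : selfAdjoint A) {t : ℝ} (ht : 0 ≤ t) :
    ‖exp (t • (Complex.I • (a : A))) - 1‖ ≤ t * ‖a‖ := by
  have : exp (t • (Complex.I • (a : A))) = (expUnitary (t • a) : A) := by
    rw [expUnitary_coe, smul_comm]
    rfl
  rw [this]
  have h := norm_expUnitary_sub_le (t • a) 0
  rwa [expUnitary_zero, sub_zero, norm_smul, Real.norm_of_nonneg ht] at h

theorem norm_expUnitary_sub_sub_le {a b : selfAdjoint A} {ρ : ℝ} (ha : ‖a‖ ≤ ρ) (hb : ‖b‖ ≤ ρ) :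
    ‖(expUnitary a - expUnitary b - Complex.I • ((a : A) - b) : A)‖ ≤ ρ * ‖a - b‖ := by
  set X := Complex.I • (a : A)
  set Y := Complex.I • (b : A)
  have hXY : ‖X - Y‖ = ‖a - b‖ := by
    rw [← smul_sub, norm_smul, Complex.norm_I, one_mul]
    rfl
  have h := norm_image_sub_le_of_norm_deriv_le_segment_01' (C := ρ * ‖a - b‖)
    (fun t _ => ((hasDerivAt_exp_mul_exp X Y t).sub
      ((hasDerivAt_id t).smul_const (X - Y))).hasDerivWithinAt) (fun t ht => ?_)
  · refine le_of_eq_of_le (congrArg norm ?_) h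
    simp only [Pi.sub_apply, id, one_smul, zero_smul, sub_zero, sub_self, exp_zero, mul_one,
      one_mul, expUnitary_coe, smul_sub, X, Y]
    abel
  -- The two exponentials deviate from `1` by at most `tρ` and `(1-t)ρ`, which add up to `ρ`.
  · have e : exp (t • X) * (X - Y) * exp ((1 - t) • Y) - (1 : ℝ) • (X - Y)
        = (exp (t • X) - 1) * (X - Y) * exp ((1 - t) • Y)
          + (X - Y) * (exp ((1 - t) • Y) - 1) := by
      rw [one_smul, mul_sub (X - Y), sub_mul, sub_mul, one_mul, mul_one]
      abel
    rw [e]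
    have h1 := norm_exp_smul_sub_one_le a ht.1
    have h2 := norm_exp_smul_sub_one_le b (sub_nonneg.2 ht.2.le)
    have h3 := norm_exp_smul_I_smul_le_one b (1 - t)
    calc _ ≤ ‖exp (t • X) - 1‖ * ‖X - Y‖ * ‖exp ((1 - t) • Y)‖
          + ‖X - Y‖ * ‖exp ((1 - t) • Y) - 1‖ :=
        (norm_add_le _ _).trans (add_le_add ((norm_mul_le _ _).trans
          (mul_le_mul_of_nonneg_right (norm_mul_le _ _) (norm_nonneg _))) (norm_mul_le _ _))
      _ ≤ (t * ρ) * ‖a - b‖ * 1 + ‖a - b‖ * ((1 - t) * ρ) := by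
        rw [hXY]
        have h1' := h1.trans (mul_le_mul_of_nonneg_left ha ht.1)
        have h2' := h2.trans (mul_le_mul_of_nonneg_left hb (sub_nonneg.2 ht.2.le))
        have h0 : 0 ≤ t * ρ := (norm_nonneg _).trans h1'
        gcongr
      _ = ρ * ‖a - b‖ := by ring

end Exponential

/-! ### The channel distance as a length function. -/

section ChannelLength

open scoped Matrix.Norms.L2Operator

theorem matrixOpNorm_eq_norm {d : ℕ} (A : Matrix (Fin d) (Fin d) ℂ) :
    matrixOpNorm A = ‖A‖ := rfl

theorem bddBelow_phaseDist {d : ℕ} (U V : Matrix.unitaryGroup (Fin d) ℂ) :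
    BddBelow (Set.range fun φ : ℝ => matrixOpNorm ((U : Matrix (Fin d) (Fin d) ℂ) -
      Complex.exp (φ * Complex.I) • (V : Matrix (Fin d) (Fin d) ℂ))) :=
  ⟨0, by rintro _ ⟨φ, rfl⟩; exact norm_nonneg _⟩

theorem phaseDist_le {d : ℕ} (U V : Matrix.unitaryGroup (Fin d) ℂ) (φ : ℝ) :
    phaseDist U V ≤ ‖(U : Matrix (Fin d) (Fin d) ℂ) -
      Complex.exp (φ * Complex.I) • (V : Matrix (Fin d) (Fin d) ℂ)‖ :=
  ciInf_le (bddBelow_phaseDist U V) φ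

theorem phaseDist_le_norm_sub {d : ℕ} (U V : Matrix.unitaryGroup (Fin d) ℂ) :
    phaseDist U V ≤ ‖(U : Matrix (Fin d) (Fin d) ℂ) - V‖ := by
  simpa using phaseDist_le U V 0

theorem phaseDist_eq_inv_mul {d : ℕ} (U V : Matrix.unitaryGroup (Fin d) ℂ) :
    phaseDist V U = phaseDist (U⁻¹ * V) 1 := by
  refine iInf_congr fun φ => ?_
  rw [matrixOpNorm_eq_norm, matrixOpNorm_eq_norm, ← CStarRing.norm_coe_unitary_mul U⁻¹, mul_sub, mul_smul_comm]
  simp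

theorem phaseDist_one_inv {d : ℕ} (U : Matrix.unitaryGroup (Fin d) ℂ) :
    phaseDist U⁻¹ 1 = phaseDist U 1 := by
  refine Equiv.iInf_congr (Equiv.neg ℝ) fun φ => ?_
  rw [matrixOpNorm_eq_norm, matrixOpNorm_eq_norm]
  have h : (U : Matrix (Fin d) (Fin d) ℂ) * ((U⁻¹ : Matrix.unitaryGroup (Fin d) ℂ) -
      Complex.exp (φ * Complex.I) • (1 : Matrix (Fin d) (Fin d) ℂ)) = -(Complex.exp (φ * Complex.I) •
      ((U : Matrix (Fin d) (Fin d) ℂ) - Complex.exp (-φ * Complex.I) • 1)) := by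
    rw [mul_sub, smul_sub, smul_smul, ← Complex.exp_add]
    simp
  have h2 := congrArg norm h
  rw [CStarRing.norm_coe_unitary_mul, norm_neg, norm_smul, Complex.norm_exp_ofReal_mul_I,
    one_mul] at h2
  simpa using h2.symm

theorem phaseDist_one_mul_le {d : ℕ} (U V : Matrix.unitaryGroup (Fin d) ℂ) :
    phaseDist (U * V) 1 ≤ phaseDist U 1 + phaseDist V 1 := by
  refine le_ciInf_add_ciInf fun φ ψ => (phaseDist_le _ _ (φ + ψ)).trans ?_
  have h : ((U * V : Matrix.unitaryGroup (Fin d) ℂ) : Matrix (Fin d) (Fin d) ℂ)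
      - Complex.exp ((φ + ψ : ℝ) * Complex.I) • ((1 : Matrix.unitaryGroup (Fin d) ℂ) :
        Matrix (Fin d) (Fin d) ℂ)
      = Complex.exp (ψ * Complex.I) • ((U : Matrix (Fin d) (Fin d) ℂ)
          - Complex.exp (φ * Complex.I) • ((1 : Matrix.unitaryGroup (Fin d) ℂ) :
            Matrix (Fin d) (Fin d) ℂ))
        + U * ((V : Matrix (Fin d) (Fin d) ℂ) - Complex.exp (ψ * Complex.I) •
          ((1 : Matrix.unitaryGroup (Fin d) ℂ) : Matrix (Fin d) (Fin d) ℂ)) := by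
    rw [smul_sub, smul_smul, ← Complex.exp_add, mul_sub, mul_smul_comm]
    push_cast
    rw [mul_one, ← add_mul, add_comm (ψ : ℂ)]
    abel
  rw [h]
  refine (norm_add_le _ _).trans (le_of_eq ?_)
  rw [norm_smul, Complex.norm_exp_ofReal_mul_I, one_mul, CStarRing.norm_coe_unitary_mul]
  rfl

/-- Distance of a unitary channel to the identity. -/
def channelLength {d : ℕ} (x : UnitaryChannel d) : ℝ := channelDist x 1

theorem channelDist_eq_channelLength {d : ℕ} (x y : UnitaryChannel d) :
    channelDist y x = channelLength (x⁻¹ * y) := by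
  induction x using QuotientGroup.induction_on
  induction y using QuotientGroup.induction_on
  exact phaseDist_eq_inv_mul _ _

theorem continuous_phaseDist_one (d : ℕ) :
    Continuous fun U : Matrix.unitaryGroup (Fin d) ℂ => phaseDist U 1 := by
  refine (LipschitzWith.of_le_add fun U V => ?_).continuous
  rw [← sub_le_iff_le_add]
  refine le_ciInf fun φ => ?_
  rw [sub_le_iff_le_add, add_comm]
  refine (phaseDist_le U 1 φ).trans ?_
  rw [Subtype.dist_eq, dist_eq_norm]
  exact norm_sub_le_norm_sub_add_norm_sub _ _ _

theorem isLength_channelLength (d : ℕ) : IsLength (channelLength (d := d)) where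
  continuous := QuotientGroup.isOpenQuotientMap_mk.isQuotientMap.continuous_iff.2
    (continuous_phaseDist_one d)
  one := by
    refine le_antisymm ?_ (le_ciInf fun φ => norm_nonneg _)
    exact (phaseDist_le_norm_sub (1 : Matrix.unitaryGroup (Fin d) ℂ) 1).trans (by simp)
  inv x := by
    induction x using QuotientGroup.induction_on
    exact phaseDist_one_inv _
  mul_le x y := by
    induction x using QuotientGroup.induction_on
    induction y using QuotientGroup.induction_on
    exact phaseDist_one_mul_le _ _

theorem channelLength_le_two {d : ℕ} (x : UnitaryChannel d) : channelLength x ≤ 2 := by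
  induction x using QuotientGroup.induction_on with
  | H U =>
    refine (phaseDist_le_norm_sub U 1).trans ((norm_sub_le _ _).trans ?_)
    linarith [norm_unitary_le_one U, norm_unitary_le_one (1 : Matrix.unitaryGroup (Fin d) ℂ)]

theorem channelBall_eq {d : ℕ} (x : UnitaryChannel d) (r : ℝ) :
    channelBall x r = {y | channelLength (x⁻¹ * y) ≤ r} := by
  simp only [channelBall, channelDist_eq_channelLength]

end ChannelLength

/-! ### The dimension of the space of traceless Hermitian matrices. -/

section TracelessHermitian

/-- Traceless Hermitian matrices. -/
def tracelessHermitian (d : ℕ) : Submodule ℝ (Matrix (Fin d) (Fin d) ℂ) where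
  carrier := {A | IsSelfAdjoint A ∧ A.trace = 0}
  add_mem' := fun ha hb => ⟨ha.1.add hb.1, by rw [Matrix.trace_add, ha.2, hb.2, add_zero]⟩
  zero_mem' := ⟨.zero _, Matrix.trace_zero _ _⟩
  smul_mem' := fun r A hA => ⟨(IsSelfAdjoint.all r).smul hA.1, by
    rw [Matrix.trace_smul, hA.2, smul_zero]⟩

/-- Every matrix is uniquely `A + i B + z` with traceless Hermitian `A`, `B` and a scalar `z`. -/
def tracelessDecomposition (d : ℕ) :
    (tracelessHermitian d × tracelessHermitian d × ℂ) →ₗ[ℝ] Matrix (Fin d) (Fin d) ℂ where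
  toFun p := p.1.1 + Complex.I • p.2.1.1 + p.2.2 • 1
  map_add' p q := by
    simp only [Prod.fst_add, Prod.snd_add, Submodule.coe_add, smul_add, add_smul]
    abel
  map_smul' r p := by
    simp only [Prod.smul_fst, Prod.smul_snd, Submodule.coe_smul, RingHom.id_apply, smul_add,
      smul_assoc, smul_comm r Complex.I]

theorem tracelessDecomposition_bijective (d : ℕ) [NeZero d] :
    Function.Bijective (tracelessDecomposition d) := by
  have hd : (d : ℂ) ≠ 0 := Nat.cast_ne_zero.2 (NeZero.ne d)
  constructor
  · rw [← LinearMap.ker_eq_bot, LinearMap.ker_eq_bot']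
    rintro ⟨⟨A, hA, hA'⟩, ⟨B, hB, hB'⟩, z⟩ h
    change A + Complex.I • B + z • 1 = 0 at h
    have hz : z = 0 := by
      have := congrArg Matrix.trace h
      simpa [Matrix.trace_add, Matrix.trace_smul, hA', hB', hd] using this
    subst hz
    rw [zero_smul, add_zero] at h
    have h2 := congrArg star h
    rw [star_add, star_smul, hA.star_eq, hB.star_eq, star_zero] at h2
    simp only [Complex.star_def, Complex.conj_I, neg_smul] at h2
    have hA0 : A = 0 := by
      have h3 : (2 : ℂ) • A = 0 := by
        rw [two_smul]
        calc A + A = (A + Complex.I • B) + (A + -(Complex.I • B)) := by abel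
          _ = 0 := by rw [h, h2, add_zero]
      exact (smul_eq_zero.1 h3).resolve_left two_ne_zero
    rw [hA0, zero_add] at h
    have hB0 : B = 0 := (smul_eq_zero.1 h).resolve_left Complex.I_ne_zero
    simp only [hA0, hB0]
    rfl
  · intro M
    set z : ℂ := M.trace / d
    set T : Matrix (Fin d) (Fin d) ℂ := M - z • 1
    have hT : T.trace = 0 := by
      simp [T, z, Matrix.trace_sub, Matrix.trace_smul, hd]
    have hT' : (star T).trace = 0 := by
      rw [Matrix.star_eq_conjTranspose, Matrix.trace_conjTranspose, hT, star_zero]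
    refine ⟨⟨⟨(1 / 2 : ℂ) • (T + star T), ?_, ?_⟩,
      ⟨(-Complex.I / 2 : ℂ) • (T - star T), ?_, ?_⟩, z⟩, ?_⟩
    · rw [isSelfAdjoint_iff, star_smul, star_add, star_star, add_comm]
      simp
    · rw [Matrix.trace_smul, Matrix.trace_add, hT, hT', add_zero, smul_zero]
    · rw [isSelfAdjoint_iff, star_smul, star_sub, star_star, ← neg_sub T, smul_neg, ← neg_smul]
      congr 1
      simp
      ring
    · rw [Matrix.trace_smul, Matrix.trace_sub, hT, hT', sub_zero, smul_zero]
    · change (1 / 2 : ℂ) • (T + star T) + Complex.I • ((-Complex.I / 2 : ℂ) • (T - star T)) + z • 1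
        = M
      rw [smul_smul, show Complex.I * (-Complex.I / 2) = 1 / 2 by
        linear_combination (-1 / 2 : ℂ) * Complex.I_mul_I, ← smul_add]
      have : T + star T + (T - star T) = (2 : ℂ) • T := by
        rw [two_smul]
        abel
      rw [this, smul_smul]
      simp [T]

/-- The decomposition gives `2 · dim + 2 = 2 d²` over the reals. -/
theorem finrank_tracelessHermitian (d : ℕ) [NeZero d] :
    Module.finrank ℝ (tracelessHermitian d) = d ^ 2 - 1 := by
  have h := (LinearEquiv.ofBijective _ (tracelessDecomposition_bijective d)).finrank_eq
  rw [Module.finrank_prod, Module.finrank_prod, Module.finrank_matrix,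
    Complex.finrank_real_complex, Fintype.card_fin] at h
  have : d ^ 2 = d * d := sq d
  omega

end TracelessHermitian

/-! ### The exponential chart and the volume constants. -/

section Chart

open scoped Matrix.Norms.L2Operator

open selfAdjoint

theorem norm_trace_le {d : ℕ} (M : Matrix (Fin d) (Fin d) ℂ) : ‖M.trace‖ ≤ d * ‖M‖ := by
  have h : ∀ i, ‖M i i‖ ≤ ‖M‖ := by
    intro i
    have h1 := Matrix.l2_opNorm_mulVec M (EuclideanSpace.single i (1 : ℂ))
    rw [PiLp.norm_single, norm_one, mul_one] at h1
    refine le_trans ?_ h1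
    refine le_trans (le_of_eq ?_) (PiLp.norm_apply_le _ i)
    simp
  calc ‖M.trace‖ ≤ ∑ i, ‖M i i‖ := norm_sum_le _ _
    _ ≤ ∑ _i : Fin d, ‖M‖ := Finset.sum_le_sum fun i _ => h i
    _ = d * ‖M‖ := by simp

/-- A traceless Hermitian matrix as a self-adjoint element. -/
def tracelessToSelfAdjoint {d : ℕ} (A : tracelessHermitian d) :
    selfAdjoint (Matrix (Fin d) (Fin d) ℂ) := ⟨A.1, A.2.1⟩

/-- The unitary channel generated by a traceless Hermitian matrix. -/
def expChannel {d : ℕ} (A : tracelessHermitian d) : UnitaryChannel d :=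
  QuotientGroup.mk (expUnitary (tracelessToSelfAdjoint A) : Matrix.unitaryGroup (Fin d) ℂ)

theorem continuous_expChannel (d : ℕ) : Continuous (expChannel (d := d)) := by
  refine QuotientGroup.continuous_mk.comp (continuous_expUnitary.comp ?_)
  exact Continuous.subtype_mk continuous_subtype_val _

theorem channelLength_expChannel_le {d : ℕ} (A B : tracelessHermitian d) :
    channelLength ((expChannel B)⁻¹ * expChannel A) ≤ ‖A - B‖ := by
  rw [← channelDist_eq_channelLength]
  exact (phaseDist_le_norm_sub _ _).trans (norm_expUnitary_sub_le _ _)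

/-- The difficulty is the free phase `z`. Tracelessness removes the first-order term from the trace
of `U - z V`, so this trace controls `‖1 - z‖`, and then `‖A - B‖` follows from the linearised
difference. -/
theorem norm_sub_le_channelLength {d : ℕ} [NeZero d] {A B : tracelessHermitian d}
    (hA : ‖A‖ ≤ 1 / 10) (hB : ‖B‖ ≤ 1 / 10) :
    ‖A - B‖ ≤ 4 * channelLength ((expChannel B)⁻¹ * expChannel A) := by
  rw [← channelDist_eq_channelLength, ← div_le_iff₀' (by norm_num)]
  refine le_ciInf fun φ => ?_
  rw [matrixOpNorm_eq_norm]
  have hd : (0 : ℝ) < d := Nat.cast_pos.2 (NeZero.pos d)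
  set a := tracelessToSelfAdjoint A
  set b := tracelessToSelfAdjoint B
  have h1 := norm_expUnitary_sub_sub_le (a := a) (b := b) hA hB
  have h2 := norm_expUnitary_sub_le b 0
  rw [expUnitary_zero, sub_zero] at h2
  change _ ≤ _ * ‖A - B‖ at h1
  have h2' : ‖((expUnitary b : Matrix (Fin d) (Fin d) ℂ) - 1)‖ ≤ 1 / 10 := h2.trans hB
  have hV : ‖(expUnitary b : Matrix (Fin d) (Fin d) ℂ)‖ ≤ 1 := norm_unitary_le_one _
  set U : Matrix (Fin d) (Fin d) ℂ := (expUnitary a : Matrix (Fin d) (Fin d) ℂ)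
  set V : Matrix (Fin d) (Fin d) ℂ := (expUnitary b : Matrix (Fin d) (Fin d) ℂ)
  set W := U - V - Complex.I • (A.1 - B.1)
  change ‖W‖ ≤ _ at h1
  set z := Complex.exp (φ * Complex.I)
  change _ ≤ ‖U - z • V‖
  set D := ‖A - B‖
  set δ := ‖U - z • V‖
  have e : U - z • V = W + Complex.I • (A.1 - B.1) + (1 - z) • V := by
    rw [sub_smul, one_smul]
    simp only [W]
    abel
  have hAB : (Complex.I • (A.1 - B.1)).trace = 0 := by
    rw [Matrix.trace_smul, Matrix.trace_sub, A.2.2, B.2.2, sub_zero, smul_zero]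
  have hV1 : (V - 1).trace = V.trace - d := by
    rw [Matrix.trace_sub, Matrix.trace_one, Fintype.card_fin]
  -- Since `V` is within `1/10` of `1`, its trace is close to `d` and the last term can be absorbed.
  have ht : (1 - z) * d = (U - z • V).trace - W.trace - (1 - z) * (V - 1).trace := by
    rw [e, Matrix.trace_add, Matrix.trace_add, hAB, Matrix.trace_smul, hV1, smul_eq_mul]
    ring
  have hz : ‖1 - z‖ * d ≤ d * δ + d * (1 / 10 * D) + ‖1 - z‖ * (d * (1 / 10)) := by
    have := congrArg norm ht
    rw [norm_mul, Complex.norm_natCast] at this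
    rw [this]
    refine (norm_sub_le _ _).trans (add_le_add ((norm_sub_le _ _).trans (add_le_add ?_ ?_)) ?_)
    · exact norm_trace_le _
    · exact (norm_trace_le _).trans (by gcongr)
    · rw [norm_mul]
      gcongr
      exact (norm_trace_le _).trans (by gcongr)
  have hz' : ‖1 - z‖ ≤ δ + 1 / 10 * D + ‖1 - z‖ * (1 / 10) := by
    refine le_of_mul_le_mul_right ?_ hd
    linarith
  have hD : D ≤ δ + 1 / 10 * D + ‖1 - z‖ := by
    have e2 : Complex.I • (A.1 - B.1) = (U - z • V) - W - (1 - z) • V := by rw [e]; abel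
    have e3 : D = ‖Complex.I • (A.1 - B.1)‖ := by
      rw [norm_smul, Complex.norm_I, one_mul]
      rfl
    rw [e3, e2]
    refine (norm_sub_le _ _).trans (add_le_add ((norm_sub_le _ _).trans (add_le_add le_rfl ?_)) ?_)
    · rwa [← e2, ← e3]
    · rw [norm_smul]
      exact mul_le_of_le_one_right (norm_nonneg _) hV
  linarith [norm_nonneg (1 - z), norm_nonneg (A - B), norm_nonneg (U - z • V)]

theorem mk_eq_of_smul {d : ℕ} {U V : Matrix.unitaryGroup (Fin d) ℂ} {c : ℂ}
    (h : (V : Matrix (Fin d) (Fin d) ℂ) = c • (U : Matrix (Fin d) (Fin d) ℂ)) :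
    (QuotientGroup.mk U : UnitaryChannel d) = QuotientGroup.mk V := by
  rw [QuotientGroup.eq, MonoidHom.mem_ker, map_mul, map_inv, inv_mul_eq_one]
  exact ((Unitary.conjStarAlgAut_ext_iff V U).2 ⟨c, h⟩).symm

/-- The spectrum is finite, so some point `z` of the circle avoids it; multiplication by `-z⁻¹`
moves `z` to `-1`, which is then outside the spectrum. -/
theorem exists_phase_norm_sub_one_lt {d : ℕ} (U : Matrix.unitaryGroup (Fin d) ℂ) :
    ∃ (V : Matrix.unitaryGroup (Fin d) ℂ) (c : ℂ),
      (V : Matrix (Fin d) (Fin d) ℂ) = c • (U : Matrix (Fin d) (Fin d) ℂ) ∧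
      ‖(V : Matrix (Fin d) (Fin d) ℂ) - 1‖ < 2 := by
  have hinf : Infinite Circle := by
    have := (Set.Ioc_infinite (show -Real.pi < Real.pi by linarith [Real.pi_pos])).to_subtype
    exact Circle.argEquiv.infinite_iff.2 this
  have hfin : (((↑) : Circle → ℂ) ⁻¹' spectrum ℂ (U : Matrix (Fin d) (Fin d) ℂ)).Finite :=
    (Matrix.finite_spectrum _).preimage Circle.coe_injective.injOn
  obtain ⟨z, hz⟩ : ∃ z : Circle, z ∉ _ := @Set.Finite.exists_notMem Circle _ hinf hfin
  have hz0 : (z : ℂ) ≠ 0 := Circle.coe_ne_zero z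
  have hmem : (-(z : ℂ)⁻¹) • (U : Matrix (Fin d) (Fin d) ℂ) ∈ Matrix.unitaryGroup (Fin d) ℂ := by
    rw [Matrix.mem_unitaryGroup_iff, star_smul, smul_mul_smul_comm,
      Matrix.mem_unitaryGroup_iff.1 U.2]
    have : -(z : ℂ)⁻¹ * star (-(z : ℂ)⁻¹) = 1 := by
      rw [Complex.star_def, Complex.mul_conj, Complex.normSq_eq_norm_sq]
      have : ‖(z : ℂ)‖ = 1 := Circle.norm_coe z
      simp [this]
    rw [this, one_smul]
  refine ⟨⟨_, hmem⟩, _, rfl, ?_⟩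
  rw [Unitary.norm_sub_one_lt_two_iff hmem]
  intro h
  apply hz
  have hu : IsUnit (-(z : ℂ)⁻¹) := by simp [hz0]
  obtain ⟨w, hw⟩ := hu
  have h2 : (-1 : ℂ) = w • (z : ℂ) := by
    rw [Units.smul_def, hw]
    simp [hz0]
  rw [← hw, ← Units.smul_def, h2, spectrum.unit_smul_eq_smul] at h
  exact (Set.smul_mem_smul_set_iff (a := w) (x := (z : ℂ))).1 h

/-- A suitable phase gives a logarithm `H` of norm at most `π`. Subtracting the scalar `tr H / d`
changes only the phase of the exponential and at most doubles the norm bound. -/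
theorem exists_expChannel_eq {d : ℕ} [NeZero d] (x : UnitaryChannel d) :
    ∃ A : tracelessHermitian d, ‖A‖ ≤ 2 * Real.pi ∧ expChannel A = x := by
  induction x using QuotientGroup.induction_on with
  | H U =>
  obtain ⟨V, c, hV, hlt⟩ := exists_phase_norm_sub_one_lt U
  rw [mk_eq_of_smul hV]
  have hd : (0 : ℝ) < d := Nat.cast_pos.2 (NeZero.pos d)
  set H := Unitary.argSelfAdjoint V
  have hH : ‖H‖ ≤ Real.pi := Unitary.norm_argSelfAdjoint_le_pi V
  have hexp : expUnitary H = V := expUnitary_argSelfAdjoint hlt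
  set τ : ℂ := (H : Matrix (Fin d) (Fin d) ℂ).trace / d
  have hτ : star τ = τ := by
    have : star (H : Matrix (Fin d) (Fin d) ℂ).trace = (H : Matrix (Fin d) (Fin d) ℂ).trace := by
      rw [← Matrix.trace_conjTranspose, ← Matrix.star_eq_conjTranspose, H.2.star_eq]
    simp only [τ, star_div₀, this]
    simp
  have hsa : IsSelfAdjoint (τ • (1 : Matrix (Fin d) (Fin d) ℂ)) := by
    rw [isSelfAdjoint_iff, star_smul, hτ, star_one]
  refine ⟨⟨H - τ • 1, H.2.sub hsa, ?_⟩, ?_, ?_⟩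
  · rw [Matrix.trace_sub, Matrix.trace_smul, Matrix.trace_one, Fintype.card_fin, smul_eq_mul,
      div_mul_cancel₀ _ (Nat.cast_ne_zero.2 (NeZero.ne d)), sub_self]
  · have h1 : ‖τ‖ ≤ Real.pi := by
      rw [norm_div, Complex.norm_natCast, div_le_iff₀ hd, mul_comm]
      exact (norm_trace_le _).trans (mul_le_mul_of_nonneg_left hH hd.le)
    have h2 : ‖τ • (1 : Matrix (Fin d) (Fin d) ℂ)‖ ≤ Real.pi := by
      rw [norm_smul]
      exact (mul_le_of_le_one_right (norm_nonneg _)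
        (norm_unitary_le_one (1 : unitary (Matrix (Fin d) (Fin d) ℂ)))).trans h1
    refine (norm_sub_le (H : Matrix (Fin d) (Fin d) ℂ) (τ • 1)).trans ?_
    have hH' : ‖(H : Matrix (Fin d) (Fin d) ℂ)‖ ≤ Real.pi := hH
    linarith
  · refine mk_eq_of_smul (c := NormedSpace.exp (Complex.I * τ)) ?_
    rw [← hexp, expUnitary_coe, expUnitary_coe]
    change _ = NormedSpace.exp (Complex.I * τ) •
      NormedSpace.exp (Complex.I • ((H : Matrix (Fin d) (Fin d) ℂ) - τ • 1))
    have e : Complex.I • (H : Matrix (Fin d) (Fin d) ℂ)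
        = algebraMap ℂ _ (Complex.I * τ) +
          Complex.I • ((H : Matrix (Fin d) (Fin d) ℂ) - τ • 1) := by
      rw [smul_sub, smul_smul, Algebra.algebraMap_eq_smul_one, add_sub_cancel]
    let +nondep : NormedAlgebra ℚ (Matrix (Fin d) (Fin d) ℂ) := NormedAlgebra.restrictScalars ℚ ℂ _
    rw [e, NormedSpace.exp_add_of_commute (Algebra.commutes _ _), ← NormedSpace.algebraMap_exp_comm,
      ← Algebra.smul_def]

instance UnitaryChannel.instPreconnectedSpace (d : ℕ) [NeZero d] :
    PreconnectedSpace (UnitaryChannel d) := by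
  have h := isPreconnected_range (continuous_expChannel d)
  rw [Set.range_eq_univ.2 fun x => (exists_expChannel_eq x).imp fun _ h => h.2] at h
  exact ⟨h⟩

theorem channelVol_bounds (d : ℕ) [NeZero d] {r : ℝ} (hr : 0 < r) (hr2 : r ≤ 2) :
    (1 / (3 * Real.pi) * r) ^ (d ^ 2 - 1) ≤ channelVol d r ∧
      channelVol d r ≤ (87 * r) ^ (d ^ 2 - 1) := by
  have hN := isLength_channelLength d
  have hπ := Real.pi_gt_three
  constructor
  · have h := hN.le_vol_of_chart (continuous_expChannel d) (K := 2 * Real.pi) (by positivity) hr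
      exists_expChannel_eq channelLength_expChannel_le
    rw [finrank_tracelessHermitian] at h
    refine le_trans ?_ h
    refine pow_le_pow_left₀ (by positivity) ?_ _
    rw [one_div_mul_eq_div]
    -- Here `2π + r ≤ 3π`, as `r ≤ 2 < π`.
    exact div_le_div_of_nonneg_left hr.le (by positivity) (by linarith)
  · have h := hN.vol_le_of_chart (continuous_expChannel d) (ρ := 1 / 10) (κ := 4) (by norm_num)
      (by norm_num) hr (fun A B hA hB => norm_sub_le_channelLength hA hB)
    rw [finrank_tracelessHermitian] at h
    refine h.trans (pow_le_pow_left₀ (by positivity) ?_ _)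
    -- The chart gives `2 · 4 / (1/10) = 80`, below `87`.
    norm_num
    linarith

end Chart

/-! ### Gaussian integrals over cones in `ℂᵈ`. -/

section GaussianVolume

theorem integral_exp_neg_mul_norm_sq_complex {b : ℝ} (hb : 0 < b) :
    ∫ z : ℂ, Real.exp (-b * ‖z‖ ^ 2) = Real.pi / b := by
  rw [GaussianFourier.integral_rexp_neg_mul_sq_norm hb, Complex.finrank_real_complex]
  simp

theorem lintegral_gaussian_pi (m : ℕ) {b : ℝ} (hb : 0 < b) :
    ∫⁻ w : Fin m → ℂ, ENNReal.ofReal (Real.exp (-b * ∑ i, ‖w i‖ ^ 2))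
      = ENNReal.ofReal ((Real.pi / b) ^ m) := by
  have h1 : Integrable fun z : ℂ => Real.exp (-b * ‖z‖ ^ 2) := by
    -- The integral of a non-integrable function is `0` by convention, so a nonzero value proves
    -- integrability.
    refine not_imp_comm.1 integral_undef ?_
    rw [integral_exp_neg_mul_norm_sq_complex hb]
    positivity
  have h2 : Integrable fun w : Fin m → ℂ => ∏ i, Real.exp (-b * ‖w i‖ ^ 2) :=
    Integrable.fintype_prod (f := fun _ z => Real.exp (-b * ‖z‖ ^ 2)) fun _ => h1
  simp_rw [Finset.mul_sum, Real.exp_sum]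
  rw [← ofReal_integral_eq_lintegral_ofReal h2 (ae_of_all _ fun w => by positivity),
    integral_fintype_prod_volume_eq_pow fun z : ℂ => Real.exp (-b * ‖z‖ ^ 2),
    integral_exp_neg_mul_norm_sq_complex hb, Fintype.card_fin]

theorem integral_Ioi_mul_exp_neg_sq (a : ℝ) :
    ∫ y in Set.Ioi a, y * Real.exp (-y ^ 2) = Real.exp (-a ^ 2) / 2 := by
  have hd : ∀ y : ℝ, HasDerivAt (fun y => -Real.exp (-y ^ 2) / 2) (y * Real.exp (-y ^ 2)) y := by
    intro y
    have h := (((hasDerivAt_pow 2 y).neg).exp.neg).div_const 2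
    convert! h using 1
    simp
    ring
  have hi : IntegrableOn (fun y : ℝ => y * Real.exp (-y ^ 2)) (Set.Ioi a) := by
    have := (integrable_mul_exp_neg_mul_sq one_pos).integrableOn (s := Set.Ioi a)
    simpa using this
  have ht : Filter.Tendsto (fun y : ℝ => -Real.exp (-y ^ 2) / 2) Filter.atTop (nhds 0) := by
    have h1 : Filter.Tendsto (fun y : ℝ => Real.exp (-y ^ 2)) Filter.atTop (nhds 0) :=
      Real.tendsto_exp_atBot.comp
        (Filter.tendsto_neg_atTop_atBot.comp (Filter.tendsto_pow_atTop two_ne_zero))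
    simpa using h1.neg.div_const 2
  rw [integral_Ioi_of_hasDerivAt_of_tendsto (hd a).continuousAt.continuousWithinAt
    (fun y _ => hd y) hi ht]
  ring

theorem integral_gaussian_tail {a : ℝ} (ha : 0 ≤ a) :
    ∫ z : ℂ, {z : ℂ | a < ‖z‖ ^ 2}.indicator (fun z => Real.exp (-‖z‖ ^ 2)) z
      = Real.pi * Real.exp (-a) := by
  have h := integral_fun_norm_addHaar (volume : Measure ℂ)
    ({y : ℝ | a < y ^ 2}.indicator fun y => Real.exp (-y ^ 2))
  have hv : (volume : Measure ℂ).real (Metric.ball 0 1) = Real.pi := by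
    simp [Measure.real]
  have hs : ∀ y ∈ Set.Ioi (0 : ℝ), y ^ (2 - 1) • ({y : ℝ | a < y ^ 2}.indicator
      (fun y => Real.exp (-y ^ 2)) y)
      = (Set.Ioi (√a)).indicator (fun y => y * Real.exp (-y ^ 2)) y := by
    intro y hy
    have : a < y ^ 2 ↔ √a < y := (Real.sqrt_lt' hy).symm
    simp only [Set.indicator, Set.mem_ofPred_eq, this, Set.mem_Ioi]
    split_ifs <;> simp
  rw [Complex.finrank_real_complex, hv, setIntegral_congr_fun measurableSet_Ioi hs,
    setIntegral_indicator measurableSet_Ioi, Set.Ioi_inter_Ioi, sup_of_le_right (Real.sqrt_nonneg a),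
    integral_Ioi_mul_exp_neg_sq, Real.sq_sqrt ha] at h
  refine Eq.trans ?_ (h.trans ?_)
  · rfl
  · rw [nsmul_eq_mul, smul_eq_mul]
    push_cast
    ring

theorem lintegral_gaussian_tail {a : ℝ} (ha : 0 ≤ a) :
    ∫⁻ z : ℂ, {z : ℂ | a ≤ ‖z‖ ^ 2}.indicator
      (fun z => ENNReal.ofReal (Real.exp (-‖z‖ ^ 2))) z
      = ENNReal.ofReal (Real.pi * Real.exp (-a)) := by
  have h1 := integral_gaussian_tail ha
  have hi : Integrable ({z : ℂ | a < ‖z‖ ^ 2}.indicator fun z => Real.exp (-‖z‖ ^ 2)) := by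
    refine not_imp_comm.1 integral_undef ?_
    rw [h1]
    positivity
  rw [← h1, ofReal_integral_eq_lintegral_ofReal hi
    (ae_of_all _ fun z => Set.indicator_nonneg (fun _ _ => (Real.exp_pos _).le) z)]
  refine lintegral_congr_ae ?_
  have hnull : volume (Metric.sphere (0 : ℂ) √a) = 0 := Measure.addHaar_sphere _ _ _
  filter_upwards [measure_eq_zero_iff_ae_notMem.1 hnull] with z hz
  have hz' : ‖z‖ ^ 2 ≠ a := fun h => hz (by simp [← h])
  have : a ≤ ‖z‖ ^ 2 ↔ a < ‖z‖ ^ 2 := ⟨fun h => h.lt_of_ne hz'.symm, le_of_lt⟩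
  simp only [Set.indicator, Set.mem_ofPred_eq, this]
  split_ifs <;> simp

/-- With `w` the remaining coordinates, the cone is `c ‖w‖² ≤ ‖z 0‖²` for `c = (1 - r²)/r²`. The
tail integral in `z 0` contributes `π exp(-c ‖w‖²)`, and `c + 1 = 1/r²` leaves a Gaussian in `w`. -/
theorem lintegral_gaussian_cone (m : ℕ) {r : ℝ} (hr : 0 < r) (hr1 : r < 1) :
    ∫⁻ z : Fin (m + 1) → ℂ, {z : Fin (m + 1) → ℂ | (1 - r ^ 2) * ∑ i, ‖z i‖ ^ 2
        ≤ ‖z 0‖ ^ 2}.indicator (fun z => ENNReal.ofReal (Real.exp (-∑ i, ‖z i‖ ^ 2))) z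
      = ENNReal.ofReal (Real.pi * (Real.pi * r ^ 2) ^ m) := by
  have hr2 : 0 < 1 - r ^ 2 := by nlinarith
  set c := (1 - r ^ 2) / r ^ 2 with hc
  have hc0 : 0 < c := by positivity
  set F : ℂ × (Fin m → ℂ) → ENNReal := fun p =>
    {p : ℂ × (Fin m → ℂ) | c * ∑ i, ‖p.2 i‖ ^ 2 ≤ ‖p.1‖ ^ 2}.indicator (fun p =>
      ENNReal.ofReal (Real.exp (-‖p.1‖ ^ 2)) *
        ENNReal.ofReal (Real.exp (-∑ i, ‖p.2 i‖ ^ 2))) p with hF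
  have hFm : Measurable F := by
    refine Measurable.indicator (by fun_prop) ?_
    exact (isClosed_le (by fun_prop) (by fun_prop)).measurableSet
  have e1 : ∀ z : Fin (m + 1) → ℂ, {z : Fin (m + 1) → ℂ | (1 - r ^ 2) * ∑ i, ‖z i‖ ^ 2
        ≤ ‖z 0‖ ^ 2}.indicator (fun z => ENNReal.ofReal (Real.exp (-∑ i, ‖z i‖ ^ 2))) z
      = F (MeasurableEquiv.piFinSuccAbove (fun _ => ℂ) 0 z) := by
    intro z
    have e2 : MeasurableEquiv.piFinSuccAbove (fun _ => ℂ) 0 z = (z 0, fun j => z j.succ) := rfl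
    have e3 : (1 - r ^ 2) * (‖z 0‖ ^ 2 + ∑ i : Fin m, ‖z i.succ‖ ^ 2) ≤ ‖z 0‖ ^ 2 ↔
        c * ∑ i : Fin m, ‖z i.succ‖ ^ 2 ≤ ‖z 0‖ ^ 2 := by
      rw [hc, div_mul_eq_mul_div, div_le_iff₀ (by positivity)]
      constructor <;> intro h <;> linarith
    rw [e2, hF]
    simp only [Set.indicator, Set.mem_ofPred_eq, Fin.sum_univ_succ, e3]
    split_ifs
    · rw [← ENNReal.ofReal_mul (Real.exp_pos _).le, ← Real.exp_add, neg_add]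
    · rfl
  simp_rw [e1]
  rw [(volume_preserving_piFinSuccAbove (fun _ => ℂ) 0).lintegral_comp hFm, Measure.volume_eq_prod,
    lintegral_prod_symm _ hFm.aemeasurable]
  have e4 : ∀ w : Fin m → ℂ, ∫⁻ x : ℂ, F (x, w)
      = ENNReal.ofReal Real.pi *
        ENNReal.ofReal (Real.exp (-(1 / r ^ 2) * ∑ i, ‖w i‖ ^ 2)) := by
    intro w
    have hS : 0 ≤ ∑ i, ‖w i‖ ^ 2 := by positivity
    have e5 : ∀ x : ℂ, F (x, w) = {z : ℂ | c * ∑ i, ‖w i‖ ^ 2 ≤ ‖z‖ ^ 2}.indicator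
        (fun z => ENNReal.ofReal (Real.exp (-‖z‖ ^ 2))) x
        * ENNReal.ofReal (Real.exp (-∑ i, ‖w i‖ ^ 2)) := by
      intro x
      simp only [hF, Set.indicator, Set.mem_ofPred_eq]
      split_ifs
      · rfl
      · rw [zero_mul]
    simp_rw [e5]
    rw [lintegral_mul_const' _ _ ENNReal.ofReal_ne_top, lintegral_gaussian_tail (by positivity),
      ENNReal.ofReal_mul Real.pi_pos.le, mul_assoc, ← ENNReal.ofReal_mul (Real.exp_pos _).le,
      ← Real.exp_add]
    congr 3
    rw [hc]
    field_simp
    ring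
  simp_rw [e4]
  rw [lintegral_const_mul' _ _ ENNReal.ofReal_ne_top, lintegral_gaussian_pi m (by positivity),
    ← ENNReal.ofReal_mul Real.pi_pos.le]
  congr 3
  field_simp

/-- The real determinant of a complex linear map is the squared modulus of its complex determinant,
here `1`. -/
theorem measurePreserving_unitary_mulVec {d : ℕ} (U : Matrix.unitaryGroup (Fin d) ℂ) :
    MeasurePreserving (fun z : Fin d → ℂ => (U : Matrix (Fin d) (Fin d) ℂ) *ᵥ z) := by
  set f : (Fin d → ℂ) →ₗ[ℝ] (Fin d → ℂ) :=
    (Matrix.toLin' (U : Matrix (Fin d) (Fin d) ℂ)).restrictScalars ℝ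
  have hdet : LinearMap.det f = 1 := by
    have h1 : ‖(U : Matrix (Fin d) (Fin d) ℂ).det‖ = 1 := by
      have h2 := congrArg Matrix.det (Matrix.mem_unitaryGroup_iff.1 U.2)
      rw [Matrix.det_mul, Matrix.star_eq_conjTranspose, Matrix.det_conjTranspose, Matrix.det_one,
        Complex.star_def, Complex.mul_conj, Complex.normSq_eq_norm_sq] at h2
      have h3 : ‖(U : Matrix (Fin d) (Fin d) ℂ).det‖ ^ 2 = 1 := by exact_mod_cast h2
      exact (pow_eq_one_iff_of_nonneg (norm_nonneg _) two_ne_zero).1 h3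
    rw [LinearMap.det_restrictScalars, LinearMap.det_toLin', Algebra.norm_complex_apply,
      Complex.normSq_eq_norm_sq, h1, one_pow]
  refine ⟨by fun_prop, ?_⟩
  have := Measure.map_linearMap_addHaar_eq_smul_addHaar (volume : Measure (Fin d → ℂ)) (f := f)
    (by rw [hdet]; exact one_ne_zero)
  rw [hdet, inv_one, abs_one, ENNReal.ofReal_one, one_smul] at this
  exact this

end GaussianVolume

/-! ### Trace distance, overlap and transitivity on pure states. -/

namespace PureState

open scoped Matrix.Norms.L2Operator ComplexOrder

variable {d : ℕ}

theorem star_eq (ρ : PureState d) : star ρ.1 = ρ.1 := by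
  obtain ⟨v, hv, hρ⟩ := ρ.2
  rw [hρ, Matrix.star_eq_conjTranspose, Matrix.conjTranspose_vecMulVec, star_star]

theorem trace_eq_one (ρ : PureState d) : ρ.1.trace = 1 := by
  obtain ⟨v, hv, hρ⟩ := ρ.2
  rw [hρ, Matrix.trace_vecMulVec, dotProduct_comm, hv]

theorem mul_mul_eq (ρ : PureState d) (M : Matrix (Fin d) (Fin d) ℂ) :
    ρ.1 * M * ρ.1 = (ρ.1 * M).trace • ρ.1 := by
  obtain ⟨v, hv, hρ⟩ := ρ.2
  rw [hρ, Matrix.vecMulVec_mul, Matrix.vecMulVec_mul_vecMulVec, Matrix.trace_vecMulVec,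
    dotProduct_comm]
  ext i j
  simp [Matrix.vecMulVec_apply]
  ring

theorem mul_self (ρ : PureState d) : ρ.1 * ρ.1 = ρ.1 := by
  have := ρ.mul_mul_eq 1
  rwa [mul_one, trace_eq_one, one_smul] at this

/-- Overlap `tr(ρσ)` of two pure states. -/
def overlap (ρ σ : PureState d) : ℝ := (ρ.1 * σ.1).trace.re

theorem trace_mul (ρ σ : PureState d) : (ρ.1 * σ.1).trace = (overlap ρ σ : ℂ) := by
  have h : star (ρ.1 * σ.1).trace = (ρ.1 * σ.1).trace := by
    rw [← Matrix.trace_conjTranspose, ← Matrix.star_eq_conjTranspose, star_mul, star_eq, star_eq,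
      Matrix.trace_mul_comm]
  exact (Complex.conj_eq_iff_re.1 h).symm

theorem overlap_comm (ρ σ : PureState d) : overlap ρ σ = overlap σ ρ := by
  rw [overlap, Matrix.trace_mul_comm, overlap]

theorem overlap_nonneg (ρ σ : PureState d) : 0 ≤ overlap ρ σ := by
  obtain ⟨v, hv, hρ⟩ := ρ.2
  obtain ⟨w, hw, hσ⟩ := σ.2
  have h : (ρ.1 * σ.1).trace = (star v ⬝ᵥ w) * star (star v ⬝ᵥ w) := by
    rw [hρ, hσ, Matrix.vecMulVec_mul_vecMulVec, Matrix.trace_vecMulVec, dotProduct_smul,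
      ← Matrix.star_dotProduct_star, star_star, smul_eq_mul, dotProduct_comm v]
  rw [overlap, h, Complex.star_def, Complex.mul_conj, Complex.ofReal_re]
  exact Complex.normSq_nonneg _

theorem isSelfAdjoint_sub (ρ σ : PureState d) : IsSelfAdjoint (ρ.1 - σ.1) := by
  rw [isSelfAdjoint_iff, star_sub, star_eq, star_eq]

theorem sub_mul_sub (ρ σ : PureState d) :
    (ρ.1 - σ.1) * (ρ.1 - σ.1) = ρ.1 + σ.1 - ρ.1 * σ.1 - σ.1 * ρ.1 := by
  rw [sub_mul, mul_sub, mul_sub, mul_self, mul_self]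
  abel

theorem trace_sub_mul_sub (ρ σ : PureState d) :
    ((ρ.1 - σ.1) * (ρ.1 - σ.1)).trace = ((2 * (1 - overlap ρ σ) : ℝ) : ℂ) := by
  rw [sub_mul_sub, Matrix.trace_sub, Matrix.trace_sub, Matrix.trace_add, trace_mul, trace_mul,
    trace_eq_one, trace_eq_one, overlap_comm σ ρ]
  push_cast
  ring

/-- The source of both norm formulas: `(ρ-σ)²` is idempotent up to the factor `1 - overlap ρ σ`. -/
theorem sub_pow_three (ρ σ : PureState d) :
    (ρ.1 - σ.1) * (ρ.1 - σ.1) * (ρ.1 - σ.1) = ((1 - overlap ρ σ : ℝ) : ℂ) • (ρ.1 - σ.1) := by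
  have h1 := ρ.mul_mul_eq σ.1
  have h2 := σ.mul_mul_eq ρ.1
  rw [trace_mul] at h1 h2
  rw [overlap_comm] at h2
  have h3 : ρ.1 * σ.1 * σ.1 = ρ.1 * σ.1 := by rw [mul_assoc, mul_self]
  have h4 : σ.1 * ρ.1 * ρ.1 = σ.1 * ρ.1 := by rw [mul_assoc, mul_self]
  rw [sub_mul_sub]
  simp only [sub_mul, add_mul, mul_sub, mul_self, h1, h2, h3, h4]
  push_cast
  module

theorem sq_mul_sq (ρ σ : PureState d) :
    ((ρ.1 - σ.1) * (ρ.1 - σ.1)) * ((ρ.1 - σ.1) * (ρ.1 - σ.1))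
      = ((1 - overlap ρ σ : ℝ) : ℂ) • ((ρ.1 - σ.1) * (ρ.1 - σ.1)) := by
  rw [← mul_assoc, sub_pow_three, smul_mul_assoc]

theorem norm_sub_sq (ρ σ : PureState d) : ‖ρ.1 - σ.1‖ ^ 2 = 1 - overlap ρ σ := by
  have hA := isSelfAdjoint_sub ρ σ
  have hA2 : IsSelfAdjoint ((ρ.1 - σ.1) * (ρ.1 - σ.1)) := by
    rw [isSelfAdjoint_iff, star_mul, hA.star_eq]
  have ht := trace_sub_mul_sub ρ σ
  by_cases h0 : ρ.1 - σ.1 = 0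
  · rw [h0, mul_zero, Matrix.trace_zero] at ht
    have : 2 * (1 - overlap ρ σ) = 0 := by exact_mod_cast ht.symm
    rw [h0, norm_zero]
    linarith
  · have h1 := hA.norm_mul_self
    have h2 := hA2.norm_mul_self
    rw [sq_mul_sq, norm_smul, Complex.norm_real, Real.norm_eq_abs, h1, sq (‖ρ.1 - σ.1‖ ^ 2)] at h2
    have hpos : 0 < ‖ρ.1 - σ.1‖ ^ 2 := by
      have := norm_pos_iff.2 h0
      positivity
    have h3 := mul_right_cancel₀ hpos.ne' h2
    have hnn : 0 ≤ 1 - overlap ρ σ := by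
      have h5 : 0 ≤ (((ρ.1 - σ.1)ᴴ * (ρ.1 - σ.1)).trace) :=
        (Matrix.posSemidef_conjTranspose_mul_self _).trace_nonneg
      rw [← Matrix.star_eq_conjTranspose, hA.star_eq, ht, Complex.zero_le_real] at h5
      linarith
    rw [← h3, abs_of_nonneg hnn]

/-- The eigenvalues of `(ρ-σ)²` are `0` or `p = ‖ρ-σ‖²` and sum to `2p`. Multiplying the trace norm
by `‖ρ-σ‖ = √p` turns the roots back into eigenvalues and avoids counting multiplicities. -/
theorem traceNorm_sub (ρ σ : PureState d) : traceNorm (ρ.1 - σ.1) = 2 * ‖ρ.1 - σ.1‖ := by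
  set A := ρ.1 - σ.1 with hAdef
  have hA : IsSelfAdjoint A := isSelfAdjoint_sub ρ σ
  set p := 1 - overlap ρ σ with hp
  have hn : ‖A‖ ^ 2 = p := norm_sub_sq ρ σ
  have hsqrt : √p = ‖A‖ := by rw [← hn, Real.sqrt_sq (norm_nonneg _)]
  have hB := Matrix.isHermitian_conjTranspose_mul_self A
  have hBA : Aᴴ * A = A * A := by rw [← Matrix.star_eq_conjTranspose, hA.star_eq]
  have hB2 : (Aᴴ * A) * (Aᴴ * A) = (p : ℂ) • (Aᴴ * A) := by rw [hBA]; exact sq_mul_sq ρ σ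
  have hev : ∀ i, hB.eigenvalues i = 0 ∨ hB.eigenvalues i = p := by
    intro i
    have h1 := hB.mulVec_eigenvectorBasis i
    set v := (hB.eigenvectorBasis i).ofLp with hv
    have hv0 : v ≠ 0 := by
      intro h
      have h3 := hB.eigenvectorBasis.orthonormal.ne_zero i
      exact h3 (by ext j; exact congrFun h j)
    set l := hB.eigenvalues i
    have h2 := congrArg (fun M => M *ᵥ v) hB2
    simp only [← Matrix.mulVec_mulVec, Matrix.smul_mulVec, h1, Matrix.mulVec_smul] at h2
    obtain ⟨j, hj⟩ := Function.ne_iff.1 hv0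
    have h3 := congrFun h2 j
    simp only [Pi.smul_apply, smul_eq_mul, Complex.real_smul] at h3
    have hj' : v j ≠ 0 := hj
    have h4 : (l : ℂ) * l = p * l := by
      apply mul_right_cancel₀ hj'
      linear_combination h3
    have h5 : l * l = p * l := by exact_mod_cast h4
    by_cases hl : l = 0
    · exact Or.inl hl
    · exact Or.inr (mul_right_cancel₀ hl h5)
  have hsum : ∑ i, hB.eigenvalues i = 2 * p := by
    have h1 := hB.trace_eq_sum_eigenvalues
    have h2 : (Aᴴ * A).trace = ((2 * p : ℝ) : ℂ) := by rw [hBA]; exact trace_sub_mul_sub ρ σ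
    refine Complex.ofReal_injective ?_
    rw [← h2, h1, Complex.ofReal_sum]
    rfl
  have hsq : ∀ i, √(hB.eigenvalues i) * ‖A‖ = hB.eigenvalues i := by
    intro i
    rcases hev i with h | h
    · rw [h, Real.sqrt_zero, zero_mul]
    · rw [h, hsqrt, ← sq, hn]
  rw [traceNorm]
  by_cases h0 : ‖A‖ = 0
  · rw [h0, mul_zero]
    refine Finset.sum_eq_zero fun i _ => ?_
    have hp0 : p = 0 := by rw [← hn, h0]; norm_num
    rcases hev i with h | h
    · rw [h, Real.sqrt_zero]
    · rw [h, hp0, Real.sqrt_zero]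
  · apply mul_right_cancel₀ h0
    rw [Finset.sum_mul, Finset.sum_congr rfl fun i _ => hsq i, hsum, ← hn]
    ring

theorem stateDist_eq_norm (ρ σ : PureState d) : stateDist ρ σ = ‖ρ.1 - σ.1‖ := by
  rw [stateDist, traceNorm_sub]
  ring

theorem stateDist_sq (ρ σ : PureState d) : stateDist ρ σ ^ 2 = 1 - overlap ρ σ := by
  rw [stateDist_eq_norm, norm_sub_sq]

theorem stateDist_nonneg (ρ σ : PureState d) : 0 ≤ stateDist ρ σ := by
  rw [stateDist_eq_norm]
  exact norm_nonneg _

theorem stateDist_le_one (ρ σ : PureState d) : stateDist ρ σ ≤ 1 := by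
  have := stateDist_sq ρ σ
  have := overlap_nonneg ρ σ
  nlinarith [stateDist_nonneg ρ σ]

theorem stateDist_self (ρ : PureState d) : stateDist ρ ρ = 0 := by
  rw [stateDist_eq_norm, sub_self, norm_zero]

theorem stateDist_comm (ρ σ : PureState d) : stateDist ρ σ = stateDist σ ρ := by
  rw [stateDist_eq_norm, stateDist_eq_norm, norm_sub_rev]

theorem stateDist_triangle (ρ σ τ : PureState d) :
    stateDist ρ τ ≤ stateDist ρ σ + stateDist σ τ := by
  simp only [stateDist_eq_norm]
  exact norm_sub_le_norm_sub_add_norm_sub _ _ _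

theorem apply_mul (x y : UnitaryChannel d) (ρ : PureState d) :
    (x * y).apply ρ = x.apply (y.apply ρ) := by
  apply Subtype.ext
  simp only [UnitaryChannel.apply, map_mul]
  rfl

theorem apply_one (ρ : PureState d) : (1 : UnitaryChannel d).apply ρ = ρ := by
  apply Subtype.ext
  simp only [UnitaryChannel.apply, map_one]
  rfl

theorem _root_.UnitaryChannel.toAut_mk (U : Matrix.unitaryGroup (Fin d) ℂ)
    (M : Matrix (Fin d) (Fin d) ℂ) :
    UnitaryChannel.toAut (QuotientGroup.mk U) M
      = (U : Matrix (Fin d) (Fin d) ℂ) * M * star (U : Matrix (Fin d) (Fin d) ℂ) := rfl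

theorem overlap_apply (x : UnitaryChannel d) (ρ σ : PureState d) :
    overlap (x.apply ρ) (x.apply σ) = overlap ρ σ := by
  induction x using QuotientGroup.induction_on with
  | H U =>
  simp only [overlap, UnitaryChannel.apply]
  rw [← map_mul, UnitaryChannel.toAut_mk, Matrix.trace_mul_comm, ← mul_assoc,
    Unitary.star_mul_self_of_mem U.2, one_mul]

theorem stateDist_apply (x : UnitaryChannel d) (ρ σ : PureState d) :
    stateDist (x.apply ρ) (x.apply σ) = stateDist ρ σ := by
  rw [← sq_eq_sq₀ (stateDist_nonneg _ _) (stateDist_nonneg _ _), stateDist_sq, stateDist_sq,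
    overlap_apply]

theorem continuous_apply (ρ : PureState d) : Continuous fun x : UnitaryChannel d => x.apply ρ := by
  have h : Continuous fun x : UnitaryChannel d => x.toAut ρ.1 := by
    refine QuotientGroup.isOpenQuotientMap_mk.isQuotientMap.continuous_iff.2 ?_
    change Continuous fun U : Matrix.unitaryGroup (Fin d) ℂ =>
      (U : Matrix (Fin d) (Fin d) ℂ) * ρ.1 * star (U : Matrix (Fin d) (Fin d) ℂ)
    fun_prop
  exact h.subtype_mk _

theorem continuous_stateDist (σ : PureState d) : Continuous fun ρ => stateDist ρ σ := by
  simp only [stateDist_eq_norm]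
  exact (continuous_subtype_val.sub continuous_const).norm

/-- The isometry between the lines spanned by `v` and `w` extends to a linear isometry of the whole
space, whose matrix is unitary. -/
theorem exists_apply_eq (ρ σ : PureState d) : ∃ x : UnitaryChannel d, x.apply ρ = σ := by
  obtain ⟨v, hv, hρ⟩ := ρ.2
  obtain ⟨w, hw, hσ⟩ := σ.2
  have norm_one : ∀ u : Fin d → ℂ, star u ⬝ᵥ u = 1 →
      ‖(WithLp.toLp 2 u : EuclideanSpace ℂ (Fin d))‖ = 1 := by
    intro u hu
    have h1 := inner_self_eq_norm_sq_to_K (𝕜 := ℂ) (WithLp.toLp 2 u : EuclideanSpace ℂ (Fin d))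
    rw [EuclideanSpace.inner_eq_star_dotProduct, dotProduct_comm] at h1
    have h2 : ((‖(WithLp.toLp 2 u : EuclideanSpace ℂ (Fin d))‖ ^ 2 : ℝ) : ℂ) = 1 := by
      rw [← hu]
      exact_mod_cast h1.symm
    have h3 : ‖(WithLp.toLp 2 u : EuclideanSpace ℂ (Fin d))‖ ^ 2 = 1 := by exact_mod_cast h2
    exact (pow_eq_one_iff_of_nonneg (norm_nonneg _) two_ne_zero).1 h3
  let e1 := LinearIsometryEquiv.toSpanUnitSingleton (𝕜 := ℂ) _ (norm_one v hv)
  let e2 := LinearIsometryEquiv.toSpanUnitSingleton (𝕜 := ℂ) _ (norm_one w hw)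
  let L := ((Submodule.subtypeₗᵢ _).comp (e2.toLinearIsometry.comp
    e1.symm.toLinearIsometry)).extend
  have hL : L (WithLp.toLp 2 v) = WithLp.toLp 2 w := by
    have h1 : (WithLp.toLp 2 v : EuclideanSpace ℂ (Fin d)) = (e1 1 : EuclideanSpace ℂ (Fin d)) := by
      simp [e1]
    rw [h1, LinearIsometry.extend_apply]
    simp [e2]
  set M : Matrix (Fin d) (Fin d) ℂ := Matrix.toEuclideanLin.symm L.toLinearMap with hM
  have hMv : ∀ u : Fin d → ℂ, M *ᵥ u = (L (WithLp.toLp 2 u)).ofLp := by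
    intro u
    have h1 : Matrix.toEuclideanLin M = L.toLinearMap := by simp [hM]
    have h2 := congrArg (fun f => f (WithLp.toLp 2 u)) h1
    rw [Matrix.toLpLin_toLp] at h2
    exact congrArg WithLp.ofLp h2
  have hU : M ∈ Matrix.unitaryGroup (Fin d) ℂ := by
    rw [Matrix.mem_unitaryGroup_iff']
    ext i j
    have h1 := L.inner_map_map (WithLp.toLp 2 (Pi.single i 1)) (WithLp.toLp 2 (Pi.single j 1))
    rw [EuclideanSpace.inner_eq_star_dotProduct, EuclideanSpace.inner_eq_star_dotProduct, ← hMv,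
      ← hMv, Matrix.star_mulVec, dotProduct_comm, ← Matrix.dotProduct_mulVec,
      Matrix.mulVec_mulVec, Matrix.star_eq_conjTranspose] at *
    simpa [Matrix.one_apply, Pi.single_apply, eq_comm] using h1
  refine ⟨QuotientGroup.mk ⟨M, hU⟩, Subtype.ext ?_⟩
  have hvw : M *ᵥ v = w := by rw [hMv, hL]
  change M * ρ.1 * star M = σ.1
  rw [hρ, hσ, Matrix.mul_vecMulVec, Matrix.vecMulVec_mul, hvw, Matrix.star_eq_conjTranspose,
    ← Matrix.star_mulVec, hvw]

end PureState

/-! ### State balls as balls of a length function. -/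

section StateLength

variable {d : ℕ}

/-- Displacement of a pure state under a unitary channel. -/
def stateLength (ρ : PureState d) (x : UnitaryChannel d) : ℝ := stateDist (x.apply ρ) ρ

theorem stateDist_eq_stateLength (ρ : PureState d) (x y : UnitaryChannel d) :
    stateDist (y.apply ρ) (x.apply ρ) = stateLength ρ (x⁻¹ * y) := by
  rw [stateLength, ← PureState.stateDist_apply x _ ρ, ← PureState.apply_mul, mul_inv_cancel_left]

theorem isLength_stateLength (ρ : PureState d) : IsLength (stateLength ρ) where
  continuous := (PureState.continuous_stateDist ρ).comp (PureState.continuous_apply ρ)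
  one := by
    rw [stateLength, PureState.apply_one, PureState.stateDist_self]
  inv x := by
    have h := stateDist_eq_stateLength ρ x 1
    rw [mul_one, PureState.apply_one, PureState.stateDist_comm] at h
    exact h.symm
  mul_le x y := by
    refine (PureState.stateDist_triangle _ (x.apply ρ) _).trans ?_
    rw [PureState.apply_mul, PureState.stateDist_apply, add_comm]
    rfl

theorem measurableSet_stateBall (ψ : PureState d) (r : ℝ) : MeasurableSet (stateBall ψ r) :=
  (isClosed_le (PureState.continuous_stateDist ψ) continuous_const).measurableSet

theorem inducedMeasure_stateBall (ν : Measure (UnitaryChannel d)) (ρ : PureState d)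
    (x : UnitaryChannel d) (r : ℝ) :
    (inducedMeasure ρ ν).real (stateBall (x.apply ρ) r)
      = ν.real {y | stateLength ρ (x⁻¹ * y) ≤ r} := by
  have h : (fun y : UnitaryChannel d => y.apply ρ) ⁻¹' stateBall (x.apply ρ) r
      = {y | stateLength ρ (x⁻¹ * y) ≤ r} := by
    ext y
    change stateDist (y.apply ρ) (x.apply ρ) ≤ r ↔ _
    rw [stateDist_eq_stateLength]
    rfl
  rw [Measure.real, inducedMeasure, Measure.map_apply (UnitaryChannel.measurable_apply ρ)
    (measurableSet_stateBall _ _), h]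
  rfl

/-- Changing the reference state conjugates the group element, and Haar measure is invariant on both
sides. -/
theorem lengthVol_stateLength_eq (ρ σ : PureState d) (r : ℝ) :
    lengthVol (stateLength ρ) r = lengthVol (stateLength σ) r := by
  obtain ⟨w, rfl⟩ := PureState.exists_apply_eq σ ρ
  have h : ∀ x, stateLength (w.apply σ) x = stateLength σ (w⁻¹ * (x * w)) := by
    intro x
    rw [← stateDist_eq_stateLength, PureState.apply_mul]
    rfl
  simp only [lengthVol, h]
  exact (haarChannel_real_mul_right w {x | stateLength σ (w⁻¹ * x) ≤ r}).trans <|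
    haarChannel_real_mul_left w⁻¹ {x | stateLength σ x ≤ r}

theorem stateVol_eq_lengthVol [NeZero d] (ρ : PureState d) (r : ℝ) :
    stateVol d r = lengthVol (stateLength ρ) r := by
  rw [lengthVol_stateLength_eq ρ (basisState d), stateVol, haarState]
  have h := inducedMeasure_stateBall (haarChannel d) (basisState d) 1 r
  rw [PureState.apply_one] at h
  rw [h, lengthVol_ball]

theorem haarChannel_real_stateDist_le [NeZero d] (ρ ψ : PureState d) (r : ℝ) :
    (haarChannel d).real {x | stateDist (x.apply ρ) ψ ≤ r} = stateVol d r := by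
  obtain ⟨w, rfl⟩ := PureState.exists_apply_eq ρ ψ
  simp only [stateDist_eq_stateLength]
  rw [lengthVol_ball, stateVol_eq_lengthVol ρ]

end StateLength

/-! ### Exact volume of balls of pure states. -/

section StateVolume

variable {m : ℕ}

theorem overlap_basisState (ρ : PureState (m + 1)) :
    ρ.overlap (basisState (m + 1)) = (ρ.1 0 0).re := by
  rw [PureState.overlap, basisState, Matrix.mul_vecMulVec, Matrix.trace_vecMulVec]
  simp

/-- The unnormalised weight `⟨0| 𝒰(|z⟩⟨z|) |0⟩`. -/
def basisWeight (x : UnitaryChannel (m + 1)) (z : Fin (m + 1) → ℂ) : ℝ :=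
  (x.toAut (Matrix.vecMulVec z (star z)) 0 0).re

theorem basisWeight_mk (U : Matrix.unitaryGroup (Fin (m + 1)) ℂ) (z : Fin (m + 1) → ℂ) :
    basisWeight (QuotientGroup.mk U) z
      = ‖((U : Matrix (Fin (m + 1)) (Fin (m + 1)) ℂ) *ᵥ z) 0‖ ^ 2 := by
  rw [basisWeight, UnitaryChannel.toAut_mk, Matrix.mul_vecMulVec, Matrix.vecMulVec_mul,
    Matrix.star_eq_conjTranspose, ← Matrix.star_mulVec, Matrix.vecMulVec_apply, Pi.star_apply,
    Complex.star_def, Complex.mul_conj, Complex.ofReal_re, Complex.normSq_eq_norm_sq]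

theorem continuous_basisWeight :
    Continuous fun p : UnitaryChannel (m + 1) × (Fin (m + 1) → ℂ) => basisWeight p.1 p.2 := by
  have hq : IsOpenQuotientMap (Prod.map (QuotientGroup.mk : Matrix.unitaryGroup (Fin (m + 1)) ℂ →
      UnitaryChannel (m + 1)) (id : (Fin (m + 1) → ℂ) → _)) :=
    QuotientGroup.isOpenQuotientMap_mk.prodMap IsOpenQuotientMap.id
  refine hq.isQuotientMap.continuous_iff.2 ?_
  change Continuous fun p : Matrix.unitaryGroup (Fin (m + 1)) ℂ × (Fin (m + 1) → ℂ) =>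
    basisWeight (QuotientGroup.mk p.1) p.2
  simp only [basisWeight_mk]
  have h : Continuous fun p : Matrix.unitaryGroup (Fin (m + 1)) ℂ × (Fin (m + 1) → ℂ) =>
      (p.1 : Matrix (Fin (m + 1)) (Fin (m + 1)) ℂ) *ᵥ p.2 :=
    (continuous_subtype_val.comp continuous_fst).matrix_mulVec continuous_snd
  exact ((continuous_apply 0).comp h).norm.pow 2

theorem sum_norm_sq_eq_re (z : Fin (m + 1) → ℂ) :
    ((∑ i, ‖z i‖ ^ 2 : ℝ) : ℂ) = star z ⬝ᵥ z := by
  simp only [dotProduct, Pi.star_apply, Complex.star_def, ← Complex.normSq_eq_conj_mul_self,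
    Complex.normSq_eq_norm_sq]
  push_cast
  rfl

theorem sum_norm_sq_mulVec (U : Matrix.unitaryGroup (Fin (m + 1)) ℂ) (z : Fin (m + 1) → ℂ) :
    ∑ i, ‖((U : Matrix (Fin (m + 1)) (Fin (m + 1)) ℂ) *ᵥ z) i‖ ^ 2 = ∑ i, ‖z i‖ ^ 2 := by
  apply Complex.ofReal_injective
  rw [sum_norm_sq_eq_re, sum_norm_sq_eq_re, Matrix.star_mulVec, Matrix.dotProduct_mulVec,
    Matrix.vecMul_vecMul, ← Matrix.star_eq_conjTranspose, Unitary.star_mul_self_of_mem U.2,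
    Matrix.vecMul_one]

/-- Both sides of the inequality scale by the same factor in `z`, so `z` can be normalised; then it
says that the rotated state is within `r` of the basis state. -/
theorem haarChannel_real_basisWeight {z : Fin (m + 1) → ℂ} (hz : z ≠ 0) {r : ℝ} (hr : 0 ≤ r) :
    (haarChannel (m + 1)).real {x | (1 - r ^ 2) * ∑ i, ‖z i‖ ^ 2 ≤ basisWeight x z}
      = stateVol (m + 1) r := by
  set s := ∑ i, ‖z i‖ ^ 2 with hs
  have hs0 : 0 < s := by
    obtain ⟨i, hi⟩ := Function.ne_iff.1 hz
    have hi' : 0 < ‖z i‖ ^ 2 := by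
      have : 0 < ‖z i‖ := norm_pos_iff.2 hi
      positivity
    exact hi'.trans_le (Finset.single_le_sum (f := fun i => ‖z i‖ ^ 2)
      (fun j _ => by positivity) (Finset.mem_univ i))
  have hsC : (s : ℂ) ≠ 0 := Complex.ofReal_ne_zero.2 hs0.ne'
  have hsq : ((√s : ℝ) : ℂ) * ((√s : ℝ) : ℂ) = s := by
    rw [← Complex.ofReal_mul, Real.mul_self_sqrt hs0.le]
  set v : Fin (m + 1) → ℂ := ((√s : ℝ) : ℂ)⁻¹ • z with hv
  have hvv : star v ⬝ᵥ v = 1 := by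
    rw [hv, star_smul, smul_dotProduct, dotProduct_smul, ← sum_norm_sq_eq_re, ← hs, smul_eq_mul,
      smul_eq_mul, star_inv₀, Complex.star_def, Complex.conj_ofReal, ← mul_assoc, ← mul_inv, hsq,
      inv_mul_cancel₀ hsC]
  have hmat : Matrix.vecMulVec v (star v) = (s : ℂ)⁻¹ • Matrix.vecMulVec z (star z) := by
    rw [hv, star_smul, Matrix.smul_vecMulVec, Matrix.vecMulVec_smul, smul_smul, star_inv₀,
      Complex.star_def, Complex.conj_ofReal, ← mul_inv, hsq]
  rw [← haarChannel_real_stateDist_le ⟨_, v, hvv, rfl⟩ (basisState (m + 1)) r]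
  congr 1
  ext x
  set ρ : PureState (m + 1) := ⟨Matrix.vecMulVec v (star v), v, hvv, rfl⟩
  have h1 : (x.apply ρ).overlap (basisState (m + 1)) = s⁻¹ * basisWeight x z := by
    rw [overlap_basisState, basisWeight]
    change (x.toAut (Matrix.vecMulVec v (star v)) 0 0).re = _
    rw [hmat, map_smul, Matrix.smul_apply, smul_eq_mul, ← Complex.ofReal_inv,
      Complex.re_ofReal_mul]
  have h2 := PureState.stateDist_sq (x.apply ρ) (basisState (m + 1))
  rw [h1] at h2
  rw [Set.mem_ofPred_eq, Set.mem_ofPred_eq, ← sq_le_sq₀ (PureState.stateDist_nonneg _ _) hr, h2,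
    sub_le_comm, inv_mul_eq_div, le_div_iff₀ hs0]

/-- A Gaussian on pairs `(x, z)` is integrated in two orders. For fixed `x`, unitary invariance
gives the cone integral `π (π r²)^m`; for fixed `z ≠ 0`, the Haar measure of the slice is the ball
volume, giving `π^(m+1)` times it. -/
theorem stateVol_succ (m : ℕ) {r : ℝ} (hr : 0 < r) (hr1 : r < 1) :
    stateVol (m + 1) r = r ^ (2 * m) := by
  set g : (Fin (m + 1) → ℂ) → ENNReal := fun z => ENNReal.ofReal (Real.exp (-∑ i, ‖z i‖ ^ 2))
    with hg
  have hgm : Measurable g := by fun_prop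
  set W : Set (UnitaryChannel (m + 1) × (Fin (m + 1) → ℂ)) :=
    {p | (1 - r ^ 2) * ∑ i, ‖p.2 i‖ ^ 2 ≤ basisWeight p.1 p.2} with hW
  have hWm : MeasurableSet W :=
    (isClosed_le (by fun_prop) continuous_basisWeight).measurableSet
  have hF : Measurable (W.indicator fun p => g p.2) :=
    (hgm.comp measurable_snd).indicator hWm
  have hl : ∫⁻ p, W.indicator (fun p => g p.2) p ∂((haarChannel (m + 1)).prod volume)
      = ENNReal.ofReal (Real.pi * (Real.pi * r ^ 2) ^ m) := by
    rw [lintegral_prod _ hF.aemeasurable, ← lintegral_gaussian_cone m hr hr1]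
    refine (lintegral_congr (g := fun _ => _) fun x => ?_).trans (by
      rw [lintegral_const, measure_univ, mul_one])
    induction x using QuotientGroup.induction_on with
    | H U =>
    have hmp := measurePreserving_unitary_mulVec U
    rw [← hmp.lintegral_comp (hgm.indicator
      (isClosed_le (by fun_prop) (by fun_prop)).measurableSet)]
    refine lintegral_congr fun z => ?_
    simp only [Set.indicator, hW, hg, Set.mem_ofPred_eq, basisWeight_mk, sum_norm_sq_mulVec]
  have hr' : ∫⁻ p, W.indicator (fun p => g p.2) p ∂((haarChannel (m + 1)).prod volume)
      = ENNReal.ofReal (stateVol (m + 1) r) * ENNReal.ofReal (Real.pi ^ (m + 1)) := by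
    have h1 := lintegral_gaussian_pi (m + 1) one_pos
    simp only [neg_mul, one_mul, div_one] at h1
    rw [lintegral_prod_symm _ hF.aemeasurable, ← h1, ← lintegral_const_mul _ hgm]
    have hnull : volume ({0} : Set (Fin (m + 1) → ℂ)) = 0 := measure_singleton 0
    refine lintegral_congr_ae ?_
    filter_upwards [measure_eq_zero_iff_ae_notMem.1 hnull] with z hz
    have e : ∀ x, W.indicator (fun p => g p.2) (x, z)
        = {x | (1 - r ^ 2) * ∑ i, ‖z i‖ ^ 2 ≤ basisWeight x z}.indicator (fun _ => g z) x := by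
      intro x
      simp only [Set.indicator, hW, Set.mem_ofPred_eq]
    have hm : MeasurableSet {x : UnitaryChannel (m + 1) |
        (1 - r ^ 2) * ∑ i, ‖z i‖ ^ 2 ≤ basisWeight x z} :=
      (isClosed_le continuous_const (continuous_basisWeight.comp
        (continuous_id.prodMk continuous_const))).measurableSet
    simp_rw [e]
    rw [lintegral_indicator_const hm, ← haarChannel_real_basisWeight hz hr.le, ofReal_measureReal,
      mul_comm]
  have hv0 : 0 ≤ stateVol (m + 1) r := measureReal_nonneg
  rw [hl, ← ENNReal.ofReal_mul hv0] at hr'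
  have h := congrArg ENNReal.toReal hr'
  rw [ENNReal.toReal_ofReal (by positivity), ENNReal.toReal_ofReal (mul_nonneg hv0
    (by positivity))] at h
  have hpi : (0 : ℝ) < Real.pi ^ (m + 1) := by positivity
  apply mul_right_cancel₀ hpi.ne'
  rw [← h, pow_mul]
  ring

theorem stateVol_eq_pow {d : ℕ} [NeZero d] {r : ℝ} (hr : 0 < r) (hr1 : r < 1) :
    stateVol d r = r ^ (2 * (d - 1)) := by
  obtain ⟨m, rfl⟩ := Nat.exists_eq_succ_of_ne_zero (NeZero.ne d)
  exact stateVol_succ m hr hr1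

end StateVolume

/-! ### Assembly and numerical constants. -/

theorem UnitaryChannel.eq_one_of_dim_le_one {d : ℕ} (hd : d ≤ 1) (x : UnitaryChannel d) :
    x = 1 := by
  have : Subsingleton (Fin d) := Fin.subsingleton_iff_le_one.2 hd
  induction x using QuotientGroup.induction_on with
  | H U =>
  rcases isEmpty_or_nonempty (Fin d) with h | ⟨⟨i⟩⟩
  · exact congrArg QuotientGroup.mk (Subsingleton.elim U 1)
  · refine (mk_eq_of_smul (U := 1) (V := U) (c := (U : Matrix (Fin d) (Fin d) ℂ) i i) ?_).symm
    ext j k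
    rw [Subsingleton.elim j i, Subsingleton.elim k i]
    simp

/-- Besides `1/(9π)`, this provides the sharper `1/(3π)`, whose extra factor is needed for the bound
in terms of `Γ`. -/
theorem isVolumeConstants_of_le {c : ℝ} (hc : 0 < c) (hc' : c ≤ 1 / (3 * Real.pi)) :
    IsVolumeConstants c 87 := by
  refine ⟨hc, by norm_num, fun d _ r hr hr2 => ?_⟩
  have h := channelVol_bounds d hr hr2
  refine ⟨le_trans ?_ h.1, h.2⟩
  gcongr

/-- Here `κ = 1/2`: a shell of given width contains balls of almost half that radius. -/
theorem isChannelEquidistributed_of_norm_le {d : ℕ} [NeZero d] {c C ε m α β : ℝ}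
    (hcC : IsVolumeConstants c C) (hε : 0 < ε) (hm0 : 0 ≤ m)
    (hα : 0 < α) (hα1 : α ≤ 1) (hβ : 1 ≤ β) (hm : m ≤ equidistributionFactor α β)
    (ν : Measure (UnitaryChannel d)) [IsProbabilityMeasure ν]
    (hδ : ‖averagingOperator ν - averagingOperator (haarChannel d)‖
      ≤ (c ^ (3 / 2 : ℝ) / C ^ (1 / 2 : ℝ) * (1 / 2 / 2) * ε * m) ^ (d ^ 2 - 1)) :
    IsChannelEquidistributed ν α β ε := by
  intro x R hR
  obtain ⟨hc, hC, hvol⟩ := hcC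
  have hN := isLength_channelLength d
  have hvol' : ∀ r, 0 < r → (∃ z : UnitaryChannel d, r < channelLength z) →
      (c * r) ^ (d ^ 2 - 1) ≤ lengthVol (channelLength (d := d)) r ∧
        lengthVol (channelLength (d := d)) r ≤ (C * r) ^ (d ^ 2 - 1) :=
    fun r hr ⟨z, hz⟩ => hvol d r hr (hz.le.trans (channelLength_le_two z))
  rw [channelBall_eq]
  refine hN.equidistributed hc hC one_half_pos hε hm0 hα hα1 hβ hvol'
    (fun s b hs hsb hb => hN.shell_of_connected (fun r hr hz => (hvol' r hr hz).1) hs hsb hb)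
    (fun h z => ?_) (hm.trans (min_le_left _ _)) (hm.trans (min_le_right _ _)) ν hδ x hR
  have hd : d ≤ 1 := by
    by_contra! h2
    have : 2 ^ 2 ≤ d ^ 2 := Nat.pow_le_pow_left h2 2
    omega
  rw [UnitaryChannel.eq_one_of_dim_le_one hd z, hN.one]

/-- The exact volume permits `c = C = κ = 1`, hence the rate `1/2`, twice the claimed one. -/
theorem isStateEquidistributed_of_norm_le {d : ℕ} [NeZero d] {ε m α β : ℝ}
    (hε : 0 < ε) (hm0 : 0 ≤ m)
    (hα : 0 < α) (hα1 : α ≤ 1) (hβ : 1 ≤ β) (hm : m ≤ equidistributionFactor α β)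
    (ν : Measure (UnitaryChannel d)) [IsProbabilityMeasure ν]
    (hδ : ‖averagingOperator ν - averagingOperator (haarChannel d)‖
      ≤ (1 / 2 * ε * m) ^ (2 * (d - 1))) (φ₀ : PureState d) :
    IsStateEquidistributed (inducedMeasure φ₀ ν) α β ε := by
  intro ψ R hR
  obtain ⟨x, rfl⟩ := PureState.exists_apply_eq φ₀ ψ
  have hN := isLength_stateLength φ₀
  have hvol : ∀ r, 0 < r → (∃ z, r < stateLength φ₀ z) →
      lengthVol (stateLength φ₀) r = r ^ (2 * (d - 1)) := fun r hr ⟨z, hz⟩ => by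
    rw [← stateVol_eq_lengthVol, stateVol_eq_pow hr (hz.trans_le (PureState.stateDist_le_one _ _))]
  have hn : 2 * (d - 1) = 0 → ∀ z, stateLength φ₀ z = 0 := fun h z => by
    rw [UnitaryChannel.eq_one_of_dim_le_one (by omega) z, hN.one]
  rw [inducedMeasure_stateBall, stateVol_eq_lengthVol φ₀, stateVol_eq_lengthVol φ₀]
  refine hN.equidistributed (n := 2 * (d - 1)) one_pos one_pos one_pos hε hm0 hα hα1 hβ
    (fun r hr hz => ?_) (fun s b hs hsb hb => ?_) hn
    (hm.trans (min_le_left _ _)) (hm.trans (min_le_right _ _)) ν (by simpa using hδ) x hR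
  · rw [hvol r hr hz, one_mul]
    exact ⟨le_rfl, le_rfl⟩
  · obtain ⟨z, hz⟩ := hb
    have hn0 : 2 * (d - 1) ≠ 0 := fun h => by
      rw [hn h z] at hz
      linarith
    rw [hvol b (hs.trans hsb) ⟨z, hz⟩, hvol s hs ⟨z, hsb.trans hz⟩, one_mul, one_mul,
      le_sub_iff_add_le]
    -- Superadditivity: `(b - s)^n + s^n ≤ b^n` for `n ≠ 0`.
    refine (pow_add_pow_le (sub_nonneg.2 hsb.le) hs.le hn0).trans_eq ?_
    rw [sub_add_cancel]

/-- The denominators are `2 + Γ` and `2 - Γ`, both at most `3`. -/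
theorem le_equidistributionFactor {Γ : ℝ} (h0 : 0 < Γ) (h1 : Γ < 1) :
    Γ ^ (3 / 2 : ℝ) / √3 ≤ equidistributionFactor (1 - Γ) (1 + Γ) := by
  have e : Γ ^ (3 / 2 : ℝ) / √3 = √(Γ ^ 3 / 3) := by
    rw [Real.sqrt_div (by positivity), Real.sqrt_eq_rpow (Γ ^ 3), ← Real.rpow_natCast,
      ← Real.rpow_mul h0.le]
    norm_num
  rw [e, equidistributionFactor, add_sub_cancel_left, sub_sub_cancel]
  refine le_min (Real.sqrt_le_sqrt ?_) (Real.sqrt_le_sqrt ?_)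
  · exact div_le_div_of_nonneg_left (by positivity) (by linarith) (by linarith)
  · exact div_le_div_of_nonneg_left (by positivity) (by linarith) (by linarith)

theorem sqrt_three_halves_mul : √(3 / 2) * √(2 / 3) = (1 : ℝ) := by
  rw [← Real.sqrt_mul (by norm_num)]
  norm_num

theorem sqrt_two_thirds_le : √(2 / 3) ≤ (1 : ℝ) := by
  rw [Real.sqrt_le_one]
  norm_num

theorem equidistributionFactor_nonneg (α β : ℝ) : 0 ≤ equidistributionFactor α β :=
  le_min (Real.sqrt_nonneg _) (Real.sqrt_nonneg _)

/-- Tripling `1/(9π)` gains `3√3`; after the loss of `√3` a factor `3 ≥ √(2/3)` remains. -/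
theorem channelConstant_le {ε Γ : ℝ} (hε : 0 < ε) (h0 : 0 < Γ) :
    channelConstant (1 / (9 * Real.pi)) 87 * ε * Γ ^ (3 / 2 : ℝ)
      ≤ (1 / (3 * Real.pi)) ^ (3 / 2 : ℝ) / 87 ^ (1 / 2 : ℝ) * (1 / 2 / 2) * ε *
        (Γ ^ (3 / 2 : ℝ) / √3) := by
  have h3 : (3 : ℝ) ^ (3 / 2 : ℝ) = 3 * √3 := by
    rw [Real.sqrt_eq_rpow, ← Real.rpow_one_add' (by norm_num) (by norm_num)]
    norm_num
  have hc : (1 / (3 * Real.pi)) ^ (3 / 2 : ℝ)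
      = 3 * √3 * (1 / (9 * Real.pi)) ^ (3 / 2 : ℝ) := by
    rw [← h3, ← Real.mul_rpow (by norm_num) (by positivity)]
    congr 1
    field_simp
    norm_num
  rw [hc, channelConstant]
  have hs : (0 : ℝ) < √3 := by positivity
  have hle : √(2 / 3) ≤ (3 : ℝ) := sqrt_two_thirds_le.trans (by norm_num)
  calc _ = (1 / (9 * Real.pi)) ^ (3 / 2 : ℝ) / 87 ^ (1 / 2 : ℝ) * (1 / 2 / 2) * ε *
        Γ ^ (3 / 2 : ℝ) * √(2 / 3) := by ring
    _ ≤ (1 / (9 * Real.pi)) ^ (3 / 2 : ℝ) / 87 ^ (1 / 2 : ℝ) * (1 / 2 / 2) * ε *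
        Γ ^ (3 / 2 : ℝ) * 3 := by gcongr
    _ = _ := by
      field_simp

theorem stateConstant_le {ε Γ : ℝ} (hε : 0 < ε) (h0 : 0 < Γ) :
    stateConstant * ε * Γ ^ (3 / 2 : ℝ) ≤ 1 / 2 * ε * (Γ ^ (3 / 2 : ℝ) / √3) := by
  have h : 1 / 4 * √(2 / 3) ≤ (1 / 2 / √3 : ℝ) := by
    have h3 : √3 ≤ (2 : ℝ) := Real.sqrt_le_iff.2 ⟨by norm_num, by norm_num⟩
    have hs : (0 : ℝ) < √3 := by positivity
    rw [le_div_iff₀ hs]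
    nlinarith [sqrt_two_thirds_le, Real.sqrt_nonneg (2 / 3 : ℝ)]
  rw [stateConstant]
  calc 1 / 4 * √(2 / 3) * ε * Γ ^ (3 / 2 : ℝ) ≤ 1 / 2 / √3 * ε * Γ ^ (3 / 2 : ℝ) := by gcongr
    _ = _ := by ring

theorem channelConstant_nonneg {c C : ℝ} (hc : 0 < c) (hC : 0 < C) : 0 ≤ channelConstant c C := by
  unfold channelConstant
  positivity

end

theorem mainTheorem3 :
    IsVolumeConstants (1 / (9 * Real.pi)) 87 ∧
    ∀ (d : ℕ) [NeZero d] (ε : ℝ), 0 < ε →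
    ∀ (ν : Measure (UnitaryChannel d)) [IsProbabilityMeasure ν],
      (∀ α β : ℝ, 0 < α → α ≤ 1 → 1 ≤ β →
        (∀ c C : ℝ, IsVolumeConstants c C →
          ‖averagingOperator ν - averagingOperator (haarChannel d)‖ ≤
            (√(3 / 2) * channelConstant c C * ε * equidistributionFactor α β) ^ (d ^ 2 - 1) →
          IsChannelEquidistributed ν α β ε) ∧
        (‖averagingOperator ν - averagingOperator (haarChannel d)‖ ≤
            (√(3 / 2) * stateConstant * ε * equidistributionFactor α β) ^ (2 * (d - 1)) →
          ∀ φ₀ : PureState d, IsStateEquidistributed (inducedMeasure φ₀ ν) α β ε)) ∧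
      (∀ Γ : ℝ, 0 < Γ → Γ < 1 →
        (‖averagingOperator ν - averagingOperator (haarChannel d)‖ ≤
            (channelConstant (1 / (9 * Real.pi)) 87 * ε * Γ ^ (3 / 2 : ℝ)) ^ (d ^ 2 - 1) →
          IsChannelEquidistributed ν (1 - Γ) (1 + Γ) ε) ∧
        (‖averagingOperator ν - averagingOperator (haarChannel d)‖ ≤
            (stateConstant * ε * Γ ^ (3 / 2 : ℝ)) ^ (2 * (d - 1)) →
          ∀ φ₀ : PureState d, IsStateEquidistributed (inducedMeasure φ₀ ν) (1 - Γ) (1 + Γ) ε)) := by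
  refine ⟨isVolumeConstants_of_le (by positivity) (by gcongr; norm_num), ?_⟩
  intro d _ ε hε ν _
  refine ⟨fun α β hα hα1 hβ => ⟨fun c C hcC hδ => ?_, fun hδ φ₀ => ?_⟩,
    fun Γ h0 h1 => ⟨fun hδ => ?_, fun hδ φ₀ => ?_⟩⟩
  · refine isChannelEquidistributed_of_norm_le hcC hε (equidistributionFactor_nonneg α β) hα hα1 hβ
      le_rfl ν (hδ.trans_eq ?_)
    congr 3
    rw [channelConstant]
    linear_combination (c ^ (3 / 2 : ℝ) / (4 * C ^ (1 / 2 : ℝ))) * sqrt_three_halves_mul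
  · have hm := equidistributionFactor_nonneg α β
    refine isStateEquidistributed_of_norm_le hε hm hα hα1 hβ le_rfl ν (hδ.trans ?_) φ₀
    have e : √(3 / 2) * stateConstant = 1 / 4 := by
      rw [stateConstant]
      linear_combination (1 / 4 : ℝ) * sqrt_three_halves_mul
    rw [e]
    gcongr
    norm_num
  · refine isChannelEquidistributed_of_norm_le (isVolumeConstants_of_le (by positivity) le_rfl) hε
      (by positivity) (by linarith) (by linarith) (by linarith) (le_equidistributionFactor h0 h1) ν
      (hδ.trans (pow_le_pow_left₀ ?_ (channelConstant_le hε h0) _))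
    have := channelConstant_nonneg (c := 1 / (9 * Real.pi)) (C := 87) (by positivity) (by norm_num)
    positivity
  · refine isStateEquidistributed_of_norm_le hε (by positivity) (by linarith) (by linarith)
      (by linarith) (le_equidistributionFactor h0 h1) ν
      (hδ.trans (pow_le_pow_left₀ ?_ (stateConstant_le hε h0) _)) φ₀
    have : 0 ≤ stateConstant := by
      unfold stateConstant
      positivity
    positivity
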